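/- **Setting.** Let $d\ge 2$, $n\ge 1$, let $\Omega\subset\mathbb R^d$ be an open set (a domain, bounded or unbounded), $Q=[0,1]^d$, $\lambda>0$, $\nu>0$. The subscript $\#$ denotes $Q$-periodicity, and summation over repeated indices is understood. Let $\rho\in L^\infty_\#(Q)$ with $\rho\ge\nu$ a.e., and let $a^{(1)},a^{(0)}\in (L^\infty_\#(Q))^{n\times d\times n\times d}$ be symmetric, $a^{(l)}_{ijpq}=a^{(l)}_{pqij}$, with $a^{(1)}_{ijpq}(y)\zeta_{ij}\zeta_{pq}\ge 0$ for all $\zeta\in\mathbb R^{n\times d}$ and a.e. $y$. Assume that there is a constant tensor $A^{(0)}$ such that for a.e. $y$ and all $\zeta\in\mathbb R^{n\times d}$, $\xi\in\mathbb R^n$, $\eta\in\mathbb R^d$ $$\bigl(a^{(0)}_{ijpq}(y)+a^{(1)}_{ijpq}(y)\bigr)\zeta_{ij}\zeta_{pq}\ \ge\ A^{(0)}_{ijpq}\zeta_{ij}\zeta_{pq},\qquad A^{(0)}_{ijpq}\xi_i\eta_j\xi_p\eta_q\ \ge\ \nu|\xi|^2|\eta|^2 .$$ For $\varepsilon>0$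 put $a^\varepsilon(x)=a^{(1)}(x/\varepsilon)+\varepsilon^2a^{(0)}(x/\varepsilon)$ and $\rho^\varepsilon(x)=\rho(x/\varepsilon)$. Let $\varepsilon$ run through a sequence of positive numbers tending to $0$, let $f^\varepsilon$ be bounded in $(L^2(\Omega))^n$ uniformly in $\varepsilon$, and let $u^\varepsilon\in (H^1_0(\Omega))^n$ be the weak solution of $-\operatorname{div}(a^\varepsilon\nabla u)+\lambda\rho^\varepsilon u=f^\varepsilon$, i.e. $$\int_\Omega\bigl[a^\varepsilon\nabla u^\varepsilon\cdot\nabla\phi+\lambda\rho^\varepsilon u^\varepsilon\cdot\phi\bigr]dx=\int_\Omega f^\varepsilon\cdot\phi\,dx\qquad\forall\,\phi\in (H^1_0(\Omega))^n .$$ Define $$V=\bigl\{v\in (H^1_\#(Q))^n:\ a^{(1)}(y)\nabla_yv=0\bigr\},$$ $$W=\bigl\{\psi\in (L^2_\#(Q))^{n\times d}:\ \operatorname{div}_y\bigl((a^{(1)}(y))^{1/2}\psi\bigr)=0\ \text{in}\ (H^{-1}_\#(Q))^n\bigr\},$$ where $H^{-1}_\#(Q)$ is the dual of $H^1_\#(Q)$.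 A sequence $w^\varepsilon$ bounded in $L^2(\Omega)$ (with values in a finite-dimensional Euclidean space) two-scale converges to $w_0\in L^2(\Omega;L^2_\#(Q))$, written $w^\varepsilon\stackrel{2}{\rightharpoonup}w_0$, if $$\int_\Omega w^\varepsilon(x)\cdot\psi\Bigl(x,\frac x\varepsilon\Bigr)dx\ \to\ \int_\Omega\int_Q w_0(x,y)\cdot\psi(x,y)\,dy\,dx\qquad\forall\,\psi\in D\bigl(\Omega;C^\infty_\#(Q)\bigr).$$ **Lemma (two-scale limits).** There exist $u_0\in L^2(\Omega;V)$ and $\xi_0\in L^2(\Omega;W)$ such that, along a common subsequence in $\varepsilon$, $$u^\varepsilon\stackrel{2}{\rightharpoonup}u_0,\qquad \varepsilon\nabla u^\varepsilon\stackrel{2}{\rightharpoonup}\nabla_yu_0,\qquad \bigl(a^{(1)}(x/\varepsilon)\bigr)^{1/2}\nabla u^\varepsilon\stackrel{2}{\rightharpoonup}\xi_0 .$$ -/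

import Mathlib

open MeasureTheory Filter Topology
open scoped Matrix MatrixOrder ContDiff ENNReal

noncomputable section

namespace TwoScale

/-- `ℝ^d` with the Euclidean norm (also used for the values `ℝ^n`). -/
abbrev E (d : ℕ) : Type := EuclideanSpace ℝ (Fin d)

/-- The space `ℝ^{n×d}` of tensors `ζ = (ζ_{ij})`, with the Frobenius inner product. -/
abbrev Tens (n d : ℕ) : Type := EuclideanSpace ℝ (Fin n × Fin d)

/-- Fourth order tensors `a = (a_{ijpq})`, as matrices with rows `(i,j)` and columns `(p,q)`. -/
abbrev Tens4 (n d : ℕ) : Type := Matrix (Fin n × Fin d) (Fin n × Fin d) ℝ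

/-- The periodicity cell `Q = [0,1]^d`. -/
def cell (d : ℕ) : Set (E d) := {y | ∀ i, y i ∈ Set.Icc (0 : ℝ) 1}

/-- `Q`-periodicity of a function on `ℝ^d`: invariance under all shifts from `ℤ^d`. -/
def QPeriodic {d : ℕ} {X : Type*} (g : E d → X) : Prop :=
  ∀ (k : Fin d → ℤ) (y : E d), g (y + WithLp.toLp 2 (fun i => (k i : ℝ))) = g y

/-- `g ∈ L^∞_#(Q)`: `g` is `Q`-periodic, measurable and essentially bounded. -/
def LinftyPer {d : ℕ} (g : E d → ℝ) : Prop :=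
  QPeriodic g ∧ MemLp g ∞ volume

/-- The classical gradient `(∇φ)_{ij} = ∂φ_i/∂x_j` of `φ : ℝ^d → ℝ^n`. -/
def grad {d n : ℕ} (φ : E d → E n) (x : E d) : Tens n d :=
  WithLp.toLp 2 (fun p => fderiv ℝ φ x (EuclideanSpace.single p.2 1) p.1)

/-- `L²(D)^n × L²(D)^{n×d}` with the Hilbert norm `(‖w‖² + ‖g‖²)^{1/2}`. An `H¹` function is
represented below by the pair of the function `w` (component `fst`) and its weak gradient `g`
(component `snd`), so that this norm is its `H¹` norm. -/
abbrev GraphSpace {d : ℕ} (n : ℕ) (D : Set (E d)) : Type :=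
  WithLp 2 (Lp (E n) 2 (volume.restrict D) × Lp (Tens n d) 2 (volume.restrict D))

/-- `(H¹_0(Ω))^n`: the closure of `C_c^∞(Ω; ℝ^n)` in the `H¹` norm. -/
def H10 {d : ℕ} (n : ℕ) (Ω : Set (E d)) : Set (GraphSpace n Ω) :=
  closure {w | ∃ φ : E d → E n, ContDiff ℝ ∞ φ ∧ HasCompactSupport φ ∧ tsupport φ ⊆ Ω ∧
    w.fst =ᵐ[volume.restrict Ω] φ ∧ w.snd =ᵐ[volume.restrict Ω] grad φ}

/-- `(H¹_#(Q))^n`: the functions of `L²(Q)^n` that have a square integrable weak gradient on the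
periodicity torus (smooth `Q`-periodic test functions). -/
def H1per (d n : ℕ) : Set (GraphSpace n (cell d)) :=
  {v | ∀ φ : E d → ℝ, ContDiff ℝ ∞ φ → QPeriodic φ → ∀ (i : Fin n) (j : Fin d),
    ∫ y in cell d, v.fst y i * fderiv ℝ φ y (EuclideanSpace.single j 1)
      = - ∫ y in cell d, v.snd y (i, j) * φ y}

/-- The action `(a ζ)_{ij} = a_{ijpq} ζ_{pq}` of a fourth order tensor. -/
def act {n d : ℕ} (a : Tens4 n d) (ζ : Tens n d) : Tens n d :=
  WithLp.toLp 2 (a *ᵥ ζ.ofLp)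

/-- The non-negative square root `a^{1/2}` of a symmetric non-negative tensor. -/
def tsqrt {n d : ℕ} (a : Tens4 n d) : Tens4 n d := CFC.sqrt a

/-- `V = {v ∈ (H¹_#(Q))^n : a(y) ∇_y v = 0}`. -/
def V {d n : ℕ} (a : E d → Tens4 n d) : Set (GraphSpace n (cell d)) :=
  {v | v ∈ H1per d n ∧ ∀ᵐ y ∂(volume.restrict (cell d)), act (a y) (v.snd y) = 0}

/-- `W = {ψ ∈ (L²_#(Q))^{n×d} : div_y (a(y)^{1/2} ψ(y)) = 0 in (H^{-1}_#(Q))^n}`, where `H^{-1}_#`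
is the dual of `H¹_#` and `⟨div_y F, w⟩ = - ∫_Q F · ∇_y w`. -/
def W {d n : ℕ} (a : E d → Tens4 n d) : Set (Lp (Tens n d) 2 (volume.restrict (cell d))) :=
  {ψ | ∀ w ∈ H1per d n,
    ∫ y in cell d, inner ℝ (act (tsqrt (a y)) (ψ y)) (w.snd y) = 0}

/-- `L²(Ω; S)` for a closed subspace `S` of a Hilbert space `H`: the Bochner square integrable
functions `Ω → H` with values a.e. in `S`. -/
def L2Into {d : ℕ} {H : Type*} [NormedAddCommGroup H] (Ω : Set (E d)) (S : Set H) :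
    Set (E d → H) :=
  {u | MemLp u 2 (volume.restrict Ω) ∧ ∀ᵐ x ∂(volume.restrict Ω), u x ∈ S}

/-- The two-scale test functions `D(Ω; C^∞_#(Q))`: smooth in `(x,y)`, `Q`-periodic in `y`, and
vanishing for `x` outside a compact subset of `Ω`. -/
def IsTestFun {d : ℕ} {F : Type*} [NormedAddCommGroup F] [NormedSpace ℝ F] (Ω : Set (E d))
    (ψ : E d → E d → F) : Prop :=
  ContDiff ℝ ∞ (fun p : E d × E d => ψ p.1 p.2) ∧ (∀ x, QPeriodic (ψ x)) ∧
    ∃ K : Set (E d), IsCompact K ∧ K ⊆ Ω ∧ ∀ x, x ∉ K → ∀ y, ψ x y = 0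

/-- Weak two-scale convergence, as `ε_k → 0`, of the sequence `w_k`, bounded in `L²(Ω; F)`, to
`w₀ ∈ L²(Ω; L²_#(Q; F))`:
`∫_Ω w_k(x) · ψ(x, x/ε_k) dx → ∫_Ω ∫_Q w₀(x,y) · ψ(x,y) dy dx` for all test functions `ψ`. -/
def TwoScaleConverges {d : ℕ} {F : Type*} [NormedAddCommGroup F] [InnerProductSpace ℝ F]
    (Ω : Set (E d)) (ε : ℕ → ℝ) (w : ℕ → E d → F)
    (w₀ : E d → Lp F 2 (volume.restrict (cell d))) : Prop :=
  (∀ k, MemLp (w k) 2 (volume.restrict Ω)) ∧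
  (∃ C : NNReal, ∀ k, eLpNorm (w k) 2 (volume.restrict Ω) ≤ C) ∧
  MemLp w₀ 2 (volume.restrict Ω) ∧
  ∀ ψ : E d → E d → F, IsTestFun Ω ψ →
    Tendsto (fun k => ∫ x in Ω, inner ℝ (w k x) (ψ x ((ε k)⁻¹ • x))) atTop
      (𝓝 (∫ x in Ω, ∫ y in cell d, inner ℝ (w₀ x y) (ψ x y)))

/-- The coefficient `a^ε(x) = a^{(1)}(x/ε) + ε² a^{(0)}(x/ε)`. -/
def aEps {d n : ℕ} (a₁ a₀ : E d → Tens4 n d) (ε : ℝ) (x : E d) : Tens4 n d :=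
  a₁ (ε⁻¹ • x) + ε ^ 2 • a₀ (ε⁻¹ • x)

/-- `u ∈ (H¹_0(Ω))^n` is a weak solution of `-div(a^ε ∇u) + λ ρ(x/ε) u = f` in `Ω`. -/
def IsWeakSolution {d n : ℕ} (Ω : Set (E d)) (a₁ a₀ : E d → Tens4 n d) (ρ : E d → ℝ)
    (lam ε : ℝ) (f : Lp (E n) 2 (volume.restrict Ω)) (u : GraphSpace n Ω) : Prop :=
  u ∈ H10 n Ω ∧ ∀ φ ∈ H10 n Ω,
    ∫ x in Ω, (inner ℝ (act (aEps a₁ a₀ ε x) (u.snd x)) (φ.snd x)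
        + lam * ρ (ε⁻¹ • x) * inner ℝ (u.fst x) (φ.fst x))
      = ∫ x in Ω, inner ℝ (f x) (φ.fst x)

end TwoScale

end

/-! Testing the equation with the solution itself bounds `u`, `ε∇u` and `a₁^{1/2}∇u` in L². Writing
`a₁ + ε²a₀ = (1-ε²)a₁ + ε²(a₀+a₁)` and using `ε² ≤ 1/2` bounds the density below by `½|a₁^{1/2}∇u|²
+ ε² A₀∇u·∇u`. The tensor `A₀` is coercive on rank-one tensors only, so its term is controlled after
integration: by Plancherel the symbol of `A₀ - ν` acts on rank-one tensors, and `H10` is the closure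
of functions extendable by zero (`setIntegral_inner_act_snd_nonneg`, `energy_estimate`).

Compactness comes from periodic unfolding, `w ↦ w(ε(⌊x/ε⌋ + y))`, which is an isometry from
`L²(ℝ^d)` into `L²(ℝ^d; L²(Q))` (`eLpNorm_unfold`). The unfolding of `ψ(x, x/ε)` converges strongly
to `ψ(x,y)` (`IsTestFun.tendsto_unfoldLp`), so weak convergence of unfoldings implies two-scale
convergence, and bounded sequences have weakly convergent subsequences. Multiplication by `a(x/ε)`
unfolds to multiplication by the fixed coefficient `a(y)` (`LinftyPerTens.unfoldAct_unfoldLp`),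
hence passes to weak limits.

The limits are identified by three arguments. Integrating by parts against `εθ(x)φ(x/ε)` shows that
the limit of `ε∇u` is the periodic gradient of `u₀` (`ae_mem_H1per`). Since `a₁(ε∇u) = ε
a₁^{1/2}(a₁^{1/2}∇u)` tends to zero in norm, `a₁∇_y u₀ = 0` (`ae_act_eq_zero`). Testing the equation
with `εθ(x)φ(x/ε)` leaves only the leading flux in the limit (`tendsto_flux_zero`), so `a₁^{1/2}ξ₀`
is orthogonal to gradients of smooth periodic functions; Parseval's identity extends this to
periodic H¹ (`integral_inner_snd_eq_zero`). -/

noncomputable section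

namespace TwoScale

/-! ### Lattice tiling of space and the measure-preserving unfolding map. -/

section Tiling

variable {d : ℕ}

/-- The lattice vector of `ℤ^d` as an element of `ℝ^d`. -/
def latticeVec (k : Fin d → ℤ) : E d := WithLp.toLp 2 (fun i => (k i : ℝ))

/-- The index of the unit lattice cell containing `x`. -/
def cellIndex (x : E d) : Fin d → ℤ := fun i => ⌊x i⌋

lemma measurable_cellIndex : Measurable (cellIndex (d := d)) :=
  measurable_pi_lambda _ fun i =>
    Int.measurable_floor.comp (by fun_prop : Measurable fun x : E d => x i)

lemma cellIndex_add (k : Fin d → ℤ) (x : E d) : cellIndex (latticeVec k + x) = k + cellIndex x := by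
  ext i
  simp [cellIndex, latticeVec]

lemma isCompact_cell : IsCompact (cell d) := by
  have h : cell d = (WithLp.toLp 2) '' (Set.Icc (0 : Fin d → ℝ) 1) := by
    ext y
    constructor
    · intro hy
      exact ⟨y.ofLp, ⟨fun i => (hy i).1, fun i => (hy i).2⟩, rfl⟩
    · rintro ⟨z, hz, rfl⟩ i
      exact ⟨hz.1 i, hz.2 i⟩
  rw [h]
  exact isCompact_Icc.image (PiLp.continuous_toLp 2 _)

lemma measurableSet_cell : MeasurableSet (cell d) := isCompact_cell.isClosed.measurableSet

lemma volume_preserving_ofLp : MeasurePreserving (WithLp.ofLp : E d → Fin d → ℝ) volume volume :=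
  EuclideanSpace.volume_preserving_symm_measurableEquiv_toLp (Fin d)

lemma cellIndex_zero_ae_eq_cell :
    (cellIndex ⁻¹' {(0 : Fin d → ℤ)} : Set (E d)) =ᵐ[volume] cell d := by
  have h := (volume_preserving_ofLp (d := d)).quasiMeasurePreserving.preimage_ae_eq
    (Measure.univ_pi_Ico_ae_eq_Icc (μ := fun _ : Fin d => (volume : Measure ℝ))
      (f := fun _ => (0 : ℝ)) (g := fun _ => 1))
  have e1 : (cellIndex ⁻¹' {(0 : Fin d → ℤ)} : Set (E d))
      = WithLp.ofLp ⁻¹' (Set.univ.pi fun _ : Fin d => Set.Ico (0 : ℝ) 1) := by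
    ext y
    simp [cellIndex, funext_iff, Int.floor_eq_zero_iff]
  have e2 : cell d = WithLp.ofLp ⁻¹' (Set.Icc (fun _ : Fin d => (0 : ℝ)) fun _ => 1) := by
    ext y
    simp [cell, Pi.le_def, forall_and]
  rw [e1, e2]
  exact h

lemma volume_cell : volume (cell d) = 1 := by
  have h := (volume_preserving_ofLp (d := d)).measure_preimage
    (measurableSet_Icc (a := (fun _ => 0 : Fin d → ℝ)) (b := fun _ => 1)).nullMeasurableSet
  rw [Real.volume_Icc_pi] at h
  simp only [sub_zero, ENNReal.ofReal_one, Finset.prod_const_one] at h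
  rw [← h]
  congr 1
  ext y
  simp [cell, Pi.le_def, forall_and]

instance : IsProbabilityMeasure (volume.restrict (cell d)) :=
  ⟨by rw [Measure.restrict_apply_univ, volume_cell]⟩

lemma restrict_cellIndex_zero :
    volume.restrict (cellIndex ⁻¹' {(0 : Fin d → ℤ)} : Set (E d)) = volume.restrict (cell d) :=
  Measure.restrict_congr_set cellIndex_zero_ae_eq_cell

lemma preimage_add_cellIndex (k : Fin d → ℤ) :
    (fun y => latticeVec k + y) ⁻¹' (cellIndex ⁻¹' {k}) = (cellIndex ⁻¹' {(0 : Fin d → ℤ)}) := by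
  ext y
  simp [cellIndex_add]

lemma volume_cellIndex_preimage (k : Fin d → ℤ) :
    volume (cellIndex ⁻¹' {k} : Set (E d)) = 1 := by
  rw [← measure_preimage_add volume (latticeVec k), preimage_add_cellIndex,
    measure_congr cellIndex_zero_ae_eq_cell, volume_cell]

/-- Half-open unit cells have measure one, so integer parts are distributed by counting measure.
This is one half of the factorisation of `unfoldMap`; `measurePreserving_latticeVec_add` is the
other. -/
lemma measurePreserving_cellIndex :
    MeasurePreserving (cellIndex (d := d)) volume Measure.count := by
  refine ⟨measurable_cellIndex, Measure.ext_of_singleton fun k => ?_⟩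
  rw [Measure.map_apply measurable_cellIndex (measurableSet_singleton k),
    volume_cellIndex_preimage, Measure.count_singleton]

lemma measurable_latticeVec_add :
    Measurable (fun p : (Fin d → ℤ) × E d => latticeVec p.1 + p.2) := by
  have : Measurable (latticeVec (d := d)) := measurable_of_countable _
  fun_prop

/-- The half-open cells partition space, so the measure of a set is the sum of the measures of its
pieces; each piece is translated back to the unit cell. -/
lemma measurePreserving_latticeVec_add :
    MeasurePreserving (fun p : (Fin d → ℤ) × E d => latticeVec p.1 + p.2)
      (Measure.count.prod (volume.restrict (cell d))) volume := by
  refine ⟨measurable_latticeVec_add, Measure.ext fun B hB => ?_⟩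
  rw [Measure.map_apply measurable_latticeVec_add hB,
    Measure.prod_apply (measurable_latticeVec_add hB), lintegral_count]
  have hk : ∀ k : Fin d → ℤ, volume.restrict (cell d)
      (Prod.mk k ⁻¹' ((fun p : (Fin d → ℤ) × E d => latticeVec p.1 + p.2) ⁻¹' B))
        = volume (B ∩ cellIndex ⁻¹' {k}) := by
    intro k
    rw [← measure_preimage_add volume (latticeVec k), Set.preimage_inter, preimage_add_cellIndex,
      ← restrict_cellIndex_zero, Measure.restrict_apply]
    · rfl
    · exact measurable_prodMk_left (measurable_latticeVec_add hB)
  simp_rw [hk]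
  rw [← measure_iUnion]
  · congr 1
    ext x
    simp
  · intro i j hij
    refine Set.disjoint_left.2 fun x hx hx' => hij ?_
    exact hx.2.symm.trans hx'.2
  · exact fun k => hB.inter (measurable_cellIndex (measurableSet_singleton k))

/-- The map `(x, y) ↦ ε (⌊x/ε⌋ + y)` behind the periodic unfolding operator. -/
def unfoldMap (ε : ℝ) (x y : E d) : E d := ε • (latticeVec (cellIndex (ε⁻¹ • x)) + y)

lemma measurable_unfoldMap (ε : ℝ) : Measurable (fun p : E d × E d => unfoldMap ε p.1 p.2) := by
  unfold unfoldMap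
  have h1 : Measurable (fun p : E d × E d => (cellIndex (ε⁻¹ • p.1), p.2)) :=
    (measurable_cellIndex.comp (by fun_prop)).prodMk measurable_snd
  exact (measurable_latticeVec_add.comp h1).const_smul ε

lemma map_smul_volume {r : ℝ} (hr : 0 < r) :
    Measure.map (fun x : E d => r • x) volume = ENNReal.ofReal ((r ^ d)⁻¹) • volume := by
  rw [Measure.map_addHaar_smul _ hr.ne', finrank_euclideanSpace_fin, abs_of_pos (by positivity)]

lemma quasiMeasurePreserving_smul {r : ℝ} (hr : 0 < r) :
    Measure.QuasiMeasurePreserving (fun x : E d => r • x) volume volume := by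
  refine ⟨by fun_prop, ?_⟩
  rw [map_smul_volume hr]
  exact Measure.smul_absolutelyContinuous

/-- At scale one, the integer part of `x` is kept and its fractional part is replaced by `y`. The
dilations by `ε⁻¹` before and `ε` after contribute reciprocal factors. -/
lemma measurePreserving_unfoldMap {ε : ℝ} (hε : 0 < ε) :
    MeasurePreserving (fun p : E d × E d => unfoldMap ε p.1 p.2)
      (volume.prod (volume.restrict (cell d))) volume := by
  refine ⟨measurable_unfoldMap ε, ?_⟩
  have h1 : MeasurePreserving (fun p : E d × E d => latticeVec (cellIndex p.1) + p.2)
      (volume.prod (volume.restrict (cell d))) volume :=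
    measurePreserving_latticeVec_add.comp
      ((measurePreserving_cellIndex (d := d)).prod (MeasurePreserving.id _))
  have hS : Measurable (fun p : E d × E d => (ε⁻¹ • p.1, p.2)) := by fun_prop
  have h2 : Measure.map (fun p : E d × E d => (ε⁻¹ • p.1, p.2))
      (volume.prod (volume.restrict (cell d)))
      = ENNReal.ofReal (ε ^ d) • volume.prod (volume.restrict (cell d)) := by
    have := Measure.map_prod_map (volume : Measure (E d)) (volume.restrict (cell d))
      (f := fun x : E d => ε⁻¹ • x) (g := id) (by fun_prop) measurable_id
    rw [map_smul_volume (inv_pos.2 hε), Measure.map_id, Measure.prod_smul_left] at this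
    rw [show ε ^ d = ((ε⁻¹) ^ d)⁻¹ by simp, this]
    rfl
  have h3 : (fun p : E d × E d => unfoldMap ε p.1 p.2) = (fun x : E d => ε • x) ∘
      (fun p : E d × E d => latticeVec (cellIndex p.1) + p.2) ∘
        (fun p : E d × E d => (ε⁻¹ • p.1, p.2)) := rfl
  rw [h3, ← Measure.map_map (by fun_prop) (h1.measurable.comp hS),
    ← Measure.map_map h1.measurable hS, h2, Measure.map_smul, h1.map_eq, Measure.map_smul,
    map_smul_volume hε, smul_smul, ← ENNReal.ofReal_mul (by positivity),
    mul_inv_cancel₀ (by positivity), ENNReal.ofReal_one, one_smul]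

end Tiling

/-! ### The periodic unfolding operator as an L² isometry. -/

section Unfolding

variable {d : ℕ} {F : Type*} [NormedAddCommGroup F]

lemma eLpNorm_two_sq {α G : Type*} [MeasurableSpace α] [NormedAddCommGroup G] (μ : Measure α)
    (f : α → G) : eLpNorm f 2 μ ^ 2 = ∫⁻ x, ‖f x‖ₑ ^ 2 ∂μ := by
  rw [eLpNorm_eq_lintegral_rpow_enorm_toReal (by simp) (by simp), ENNReal.toReal_ofNat,
    ← ENNReal.rpow_natCast, ← ENNReal.rpow_mul]
  norm_num

lemma integrable_inner_of_memLp [InnerProductSpace ℝ F] {α : Type*} [MeasurableSpace α] {μ : Measure α} {f g : α → F}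
    (hf : MemLp f 2 μ) (hg : MemLp g 2 μ) : Integrable (fun x => inner ℝ (f x) (g x)) μ := by
  refine (L2.integrable_inner (𝕜 := ℝ) hf.toLp hg.toLp).congr ?_
  filter_upwards [hf.coeFn_toLp, hg.coeFn_toLp] with x h1 h2
  rw [h1, h2]

lemma inner_toLp_toLp [InnerProductSpace ℝ F] {α : Type*} [MeasurableSpace α] {μ : Measure α} {f g : α → F}
    (hf : MemLp f 2 μ) (hg : MemLp g 2 μ) :
    inner ℝ (hf.toLp f) (hg.toLp g) = ∫ x, inner ℝ (f x) (g x) ∂μ := by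
  rw [L2.inner_def]
  refine integral_congr_ae ?_
  filter_upwards [hf.coeFn_toLp, hg.coeFn_toLp] with x h1 h2
  rw [h1, h2]

/-- The space `L²(Q; F)`. -/
abbrev CellL2 (d : ℕ) (F : Type*) [NormedAddCommGroup F] : Type _ :=
  Lp F 2 (volume.restrict (cell d))

/-- The cell has measure one, so no constant appears. -/
lemma norm_toLp_le_of_bound {f : E d → F} (hf : MemLp f 2 (volume.restrict (cell d))) {C : ℝ}
    (hC : 0 ≤ C) (h : ∀ y ∈ cell d, ‖f y‖ ≤ C) : ‖hf.toLp‖ ≤ C := by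
  have := Lp.norm_le_of_ae_bound (f := hf.toLp) hC (by
    filter_upwards [hf.coeFn_toLp, ae_restrict_mem measurableSet_cell] with y h1 h2
    rw [h1]
    exact h y h2)
  simpa [measureUnivNNReal] using this

/-- The space `L²(ℝ^d; L²(Q; F))`. -/
abbrev UnfoldL2 (d : ℕ) (F : Type*) [NormedAddCommGroup F] : Type _ :=
  Lp (CellL2 d F) 2 (volume : Measure (E d))

lemma memLp_comp_smul {w : E d → F} {p : ℝ≥0∞} (hw : MemLp w p volume) {r : ℝ} (hr : 0 < r) :
    MemLp (fun x => w (r • x)) p volume := by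
  have h : MemLp w p (Measure.map (fun x : E d => r • x) volume) := by
    rw [map_smul_volume hr]
    exact hw.smul_measure ENNReal.ofReal_ne_top
  exact (memLp_map_measure_iff h.1 (by fun_prop)).1 h

/-- For fixed `x` the map in `y` is a translation followed by a dilation, so this holds for every
`x`; consequently `unfold` never takes its default value 0 on square integrable functions. -/
lemma memLp_unfoldMap {w : E d → F} (hw : MemLp w 2 volume) {ε : ℝ} (hε : 0 < ε) (x : E d) :
    MemLp (fun y => w (unfoldMap ε x y)) 2 (volume.restrict (cell d)) :=
  ((memLp_comp_smul hw hε).comp_measurePreserving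
    (measurePreserving_add_left volume (latticeVec (cellIndex (ε⁻¹ • x))))).restrict _

open Classical in
/-- The periodic unfolding operator `(x, y) ↦ w (ε (⌊x/ε⌋ + y))`. -/
def unfold (ε : ℝ) (w : E d → F) (x : E d) : CellL2 d F :=
  if h : MemLp (fun y => w (unfoldMap ε x y)) 2 (volume.restrict (cell d)) then h.toLp else 0

lemma unfold_eq {w : E d → F} (hw : MemLp w 2 volume) {ε : ℝ} (hε : 0 < ε) (x : E d) :
    unfold ε w x = (memLp_unfoldMap hw hε x).toLp := by
  rw [unfold, dif_pos]

lemma coeFn_unfold {w : E d → F} (hw : MemLp w 2 volume) {ε : ℝ} (hε : 0 < ε) (x : E d) :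
    unfold ε w x =ᵐ[volume.restrict (cell d)] fun y => w (unfoldMap ε x y) := by
  rw [unfold_eq hw hε]
  exact MemLp.coeFn_toLp _

/-- The unfolding depends on `x` only through an integer vector, hence factors through a countable
discrete space. -/
lemma stronglyMeasurable_unfold (ε : ℝ) (w : E d → F) : StronglyMeasurable (unfold ε w) := by
  classical
  let G : (Fin d → ℤ) → CellL2 d F := fun k =>
    if h : MemLp (fun y => w (ε • (latticeVec k + y))) 2 (volume.restrict (cell d))
      then h.toLp else 0
  have hG : StronglyMeasurable G := StronglyMeasurable.of_discrete
  exact hG.comp_measurable (measurable_cellIndex.comp (by fun_prop : Measurable fun x : E d => ε⁻¹ • x))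

/-- Tonelli turns the iterated norm into an integral over the product, which
`measurePreserving_unfoldMap` transports to the whole space. -/
lemma eLpNorm_unfold {w : E d → F} (hw : MemLp w 2 volume) {ε : ℝ} (hε : 0 < ε) :
    eLpNorm (unfold ε w) 2 volume = eLpNorm w 2 volume := by
  have hΦ := measurePreserving_unfoldMap (d := d) hε
  have h : eLpNorm (unfold ε w) 2 volume ^ 2 = eLpNorm w 2 volume ^ 2 := by
    have hm : AEMeasurable (fun z => ‖w z‖ₑ ^ 2) volume := hw.1.enorm.pow_const 2
    rw [eLpNorm_two_sq, eLpNorm_two_sq]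
    have h1 : ∀ x, ‖unfold ε w x‖ₑ ^ 2
        = ∫⁻ y in cell d, ‖w (unfoldMap ε x y)‖ₑ ^ 2 := by
      intro x
      rw [Lp.enorm_def, eLpNorm_two_sq]
      refine lintegral_congr_ae ?_
      filter_upwards [coeFn_unfold hw hε x] with y hy
      rw [hy]
    simp_rw [h1]
    rw [← lintegral_prod (fun p : E d × E d => ‖w (unfoldMap ε p.1 p.2)‖ₑ ^ 2)]
    · conv_rhs => rw [← hΦ.map_eq]
      rw [lintegral_map' (by rwa [hΦ.map_eq]) hΦ.measurable.aemeasurable]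
    · exact hm.comp_quasiMeasurePreserving hΦ.quasiMeasurePreserving
  exact (ENNReal.pow_right_strictMono two_ne_zero).injective h

lemma memLp_unfold {w : E d → F} (hw : MemLp w 2 volume) {ε : ℝ} (hε : 0 < ε) :
    MemLp (unfold ε w) 2 volume :=
  ⟨(stronglyMeasurable_unfold ε w).aestronglyMeasurable, by rw [eLpNorm_unfold hw hε]; exact hw.2⟩

/-- The unfolding of a square integrable function, as an element of `L²(ℝ^d; L²(Q; F))`. -/
def unfoldLp {w : E d → F} (hw : MemLp w 2 volume) {ε : ℝ} (hε : 0 < ε) : UnfoldL2 d F :=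
  (memLp_unfold hw hε).toLp

lemma coeFn_unfoldLp {w : E d → F} (hw : MemLp w 2 volume) {ε : ℝ} (hε : 0 < ε) :
    unfoldLp hw hε =ᵐ[volume] unfold ε w :=
  MemLp.coeFn_toLp _

lemma norm_unfoldLp {w : E d → F} (hw : MemLp w 2 volume) {ε : ℝ} (hε : 0 < ε) :
    ‖unfoldLp hw hε‖ = (eLpNorm w 2 volume).toReal := by
  rw [unfoldLp, Lp.norm_toLp, eLpNorm_unfold hw hε]

lemma inner_unfoldLp [InnerProductSpace ℝ F] {w v : E d → F} (hw : MemLp w 2 volume) (hv : MemLp v 2 volume) {ε : ℝ}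
    (hε : 0 < ε) :
    inner ℝ (unfoldLp hw hε) (unfoldLp hv hε) = ∫ x, inner ℝ (w x) (v x) := by
  have hΦ := measurePreserving_unfoldMap (d := d) hε
  have hi := integrable_inner_of_memLp hw hv
  rw [unfoldLp, unfoldLp, inner_toLp_toLp]
  have h1 : ∀ x, inner ℝ (unfold ε w x) (unfold ε v x)
      = ∫ y in cell d, inner ℝ (w (unfoldMap ε x y)) (v (unfoldMap ε x y)) := by
    intro x
    rw [unfold_eq hw hε, unfold_eq hv hε, inner_toLp_toLp]
  simp_rw [h1]
  rw [← integral_prod (fun p : E d × E d =>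
    inner ℝ (w (unfoldMap ε p.1 p.2)) (v (unfoldMap ε p.1 p.2)))]
  · conv_rhs => rw [← hΦ.map_eq]
    rw [integral_map hΦ.measurable.aemeasurable (by rw [hΦ.map_eq]; exact hi.1)]
  · exact (hΦ.integrable_comp hi.1).2 hi

end Unfolding

/-! ### Two-scale test functions and the strong convergence of their unfoldings. -/

section TestFunctions

variable {d : ℕ} {F : Type*} [NormedAddCommGroup F] [InnerProductSpace ℝ F]
  {Ω : Set (E d)} {ψ : E d → E d → F}

lemma IsTestFun.continuous (hψ : IsTestFun Ω ψ) : Continuous (fun p : E d × E d => ψ p.1 p.2) :=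
  hψ.1.continuous

lemma IsTestFun.memLp_right (hψ : IsTestFun Ω ψ) (x : E d) :
    MemLp (ψ x) 2 (volume.restrict (cell d)) := by
  have hc : Continuous (ψ x) := hψ.continuous.comp (Continuous.prodMk_right x)
  obtain ⟨C, hC⟩ := isCompact_cell.exists_bound_of_continuousOn (f := ψ x) hc.continuousOn
  exact MemLp.of_bound (hc.aestronglyMeasurable) C
    ((ae_restrict_iff' measurableSet_cell).2 (Eventually.of_forall hC))

/-- A two-scale test function as a map into `L²(Q; F)`. -/
def IsTestFun.toFun (hψ : IsTestFun Ω ψ) (x : E d) : CellL2 d F := (hψ.memLp_right x).toLp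

/-- Currying gives a continuous, compactly supported map from `x` into the continuous functions on
the compact cell with the sup norm; such a map is uniformly continuous. -/
lemma IsTestFun.uniform (hψ : IsTestFun Ω ψ) {η : ℝ} (hη : 0 < η) :
    ∃ δ > 0, ∀ x x', dist x x' < δ → ∀ y ∈ cell d, ‖ψ x y - ψ x' y‖ ≤ η := by
  obtain ⟨K, hK, -, hψK⟩ := hψ.2.2
  have : CompactSpace (cell d) := isCompact_iff_compactSpace.1 isCompact_cell
  let G : C(E d × cell d, F) := ⟨fun p => ψ p.1 p.2, hψ.continuous.comp
    (by fun_prop : Continuous fun p : E d × cell d => (p.1, (p.2 : E d)))⟩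
  have hG : UniformContinuous (ContinuousMap.curry G) := by
    refine HasCompactSupport.uniformContinuous_of_continuous (HasCompactSupport.intro hK ?_)
      (ContinuousMap.curry G).continuous
    intro x hx
    ext y
    exact hψK x hx y
  obtain ⟨δ, hδ, h⟩ := Metric.uniformContinuous_iff.1 hG η hη
  refine ⟨δ, hδ, fun x x' hx y hy => ?_⟩
  have h2 := (ContinuousMap.dist_apply_le_dist (f := G.curry x) (g := G.curry x') ⟨y, hy⟩).trans
    (h hx).le
  rwa [dist_eq_norm] at h2

lemma IsTestFun.continuous_toFun (hψ : IsTestFun Ω ψ) : Continuous hψ.toFun := by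
  refine Metric.continuous_iff.2 fun x η hη => ?_
  obtain ⟨δ, hδ, h⟩ := hψ.uniform (half_pos hη)
  refine ⟨δ, hδ, fun x' hx => ?_⟩
  rw [dist_eq_norm, IsTestFun.toFun, IsTestFun.toFun, ← MemLp.toLp_sub]
  exact (norm_toLp_le_of_bound _ (by positivity) (h x' x hx)).trans_lt (half_lt_self hη)

lemma IsTestFun.toFun_eq_zero (hψ : IsTestFun Ω ψ) {x : E d} (hx : ∀ y, ψ x y = 0) :
    hψ.toFun x = 0 := by
  refine norm_le_zero_iff.1 (norm_toLp_le_of_bound _ le_rfl fun y _ => ?_)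
  rw [hx y, norm_zero]

lemma IsTestFun.memLp_toFun (hψ : IsTestFun Ω ψ) : MemLp hψ.toFun 2 volume := by
  obtain ⟨K, hK, -, hψK⟩ := hψ.2.2
  exact hψ.continuous_toFun.memLp_of_hasCompactSupport
    (HasCompactSupport.intro hK fun x hx => hψ.toFun_eq_zero (hψK x hx))

/-- A two-scale test function as an element of `L²(ℝ^d; L²(Q; F))`. -/
def IsTestFun.toLp (hψ : IsTestFun Ω ψ) : UnfoldL2 d F := hψ.memLp_toFun.toLp

lemma IsTestFun.memLp_diag (hψ : IsTestFun Ω ψ) (ε : ℝ) :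
    MemLp (fun x => ψ x (ε⁻¹ • x)) 2 volume := by
  obtain ⟨K, hK, -, hψK⟩ := hψ.2.2
  exact (hψ.continuous.comp (by fun_prop : Continuous fun x : E d => (x, ε⁻¹ • x))
    ).memLp_of_hasCompactSupport (HasCompactSupport.intro hK fun x hx => hψK x hx _)

/-- Both `y` and the fractional part of `x/ε` lie in the bounded cell, and the displacement is `ε`
times their difference. -/
lemma exists_dist_unfoldMap_le : ∃ R > 0, ∀ ε : ℝ, 0 < ε → ∀ x : E d, ∀ y ∈ cell d,
    dist (unfoldMap ε x y) x ≤ R * ε := by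
  obtain ⟨R, hR⟩ := isCompact_cell.isBounded.exists_norm_le (s := cell d)
  refine ⟨2 * |R| + 1, by positivity, fun ε hε x y hy => ?_⟩
  have hfr : ε⁻¹ • x - latticeVec (cellIndex (ε⁻¹ • x)) ∈ cell d := by
    intro i
    have h1 := Int.floor_le ((ε⁻¹ • x) i)
    have h2 := Int.lt_floor_add_one ((ε⁻¹ • x) i)
    simp only [latticeVec, cellIndex, PiLp.sub_apply, Set.mem_Icc]
    constructor <;> linarith
  have h : unfoldMap ε x y - x = ε • (y - (ε⁻¹ • x - latticeVec (cellIndex (ε⁻¹ • x)))) := by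
    rw [unfoldMap, smul_sub, smul_sub, smul_inv_smul₀ hε.ne', smul_add]
    abel
  rw [dist_eq_norm, h, norm_smul, Real.norm_of_nonneg hε.le, mul_comm]
  refine mul_le_mul_of_nonneg_right ((norm_sub_le _ _).trans ?_) hε.le
  have := hR _ hy
  have := hR _ hfr
  have := le_abs_self R
  linarith

lemma apply_add_latticeVec {X : Type*} {g : E d → X} (hg : QPeriodic g) (k : Fin d → ℤ) (y : E d) :
    g (latticeVec k + y) = g y := by
  rw [add_comm]
  exact hg k y

lemma inv_smul_unfoldMap {ε : ℝ} (hε : 0 < ε) (x y : E d) :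
    ε⁻¹ • unfoldMap ε x y = latticeVec (cellIndex (ε⁻¹ • x)) + y := by
  rw [unfoldMap, inv_smul_smul₀ hε.ne']

/-- By periodicity in the fast variable the unfolding is `ψ(unfoldMap ε x y, y)`, whose slow
argument is within `Rε` of `x`. Uniform continuity gives a sup bound, and the supports stay in a
fixed bounded set. -/
lemma IsTestFun.tendsto_unfoldLp (hψ : IsTestFun Ω ψ) {ε : ℕ → ℝ} (hε : ∀ k, 0 < ε k)
    (hε0 : Tendsto ε atTop (𝓝 0)) :
    Tendsto (fun k => unfoldLp (hψ.memLp_diag (ε k)) (hε k)) atTop (𝓝 hψ.toLp) := by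
  obtain ⟨K, hK, -, hψK⟩ := hψ.2.2
  obtain ⟨R, hR, hRε⟩ := exists_dist_unfoldMap_le (d := d)
  have hmass : volume (Metric.cthickening 1 K) < ⊤ :=
    hK.isBounded.cthickening.measure_lt_top
  have hsub : ∀ k x, unfold (ε k) (fun x => ψ x ((ε k)⁻¹ • x)) x - hψ.toFun x =
      MemLp.toLp _ ((memLp_unfoldMap (hψ.memLp_diag (ε k)) (hε k) x).sub (hψ.memLp_right x)) := by
    intro k x
    rw [unfold_eq (hψ.memLp_diag (ε k)) (hε k), IsTestFun.toFun, ← MemLp.toLp_sub]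
  have hper : ∀ k x y, ψ (unfoldMap (ε k) x y) ((ε k)⁻¹ • unfoldMap (ε k) x y)
      = ψ (unfoldMap (ε k) x y) y := by
    intro k x y
    rw [inv_smul_unfoldMap (hε k), apply_add_latticeVec (hψ.2.1 _)]
  refine (Lp.tendsto_Lp_iff_tendsto_eLpNorm'' _ _ _ _).2 ?_
  set c : ℝ≥0∞ := volume (Metric.cthickening 1 K) ^ (2 : ℝ≥0∞).toReal⁻¹ with hc
  have hctop : c ≠ ⊤ := ENNReal.rpow_ne_top_of_nonneg (by simp) hmass.ne
  have key : ∀ η : ℝ, 0 < η → ∀ᶠ k in atTop,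
      eLpNorm (unfold (ε k) (fun x => ψ x ((ε k)⁻¹ • x)) - hψ.toFun) 2 volume
        ≤ c * ENNReal.ofReal η := by
    intro η hη
    obtain ⟨δ, hδ, hu⟩ := hψ.uniform hη
    -- The bound `δ` serves uniform continuity; the bound 1 keeps the support of the unfolding in
    -- the 1-thickening of `K`.
    have hsmall : ∀ᶠ k in atTop, R * ε k < min δ 1 := by
      have : Tendsto (fun k => R * ε k) atTop (𝓝 0) := by simpa using hε0.const_mul R
      exact this.eventually_lt_const (by positivity)
    filter_upwards [hsmall] with k hk
    have hbound : ∀ x, ‖unfold (ε k) (fun x => ψ x ((ε k)⁻¹ • x)) x - hψ.toFun x‖ ≤ η := by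
      intro x
      rw [hsub]
      refine norm_toLp_le_of_bound _ hη.le fun y hy => ?_
      simp only [Pi.sub_apply, hper]
      exact hu _ _ ((hRε _ (hε k) x y hy).trans_lt (hk.trans_le (min_le_left _ _))) y hy
    rw [← eLpNorm_restrict_eq_of_support_subset (s := Metric.cthickening 1 K)]
    · refine (eLpNorm_le_of_ae_bound (Eventually.of_forall hbound)).trans ?_
      rw [Measure.restrict_apply_univ]
    · intro x hx
      by_contra hxK
      refine hx ?_
      rw [Pi.sub_apply, hsub]
      refine norm_le_zero_iff.1 (norm_toLp_le_of_bound _ le_rfl fun y hy => ?_)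
      have hx0 : x ∉ K := fun h => hxK (Metric.self_subset_cthickening K h)
      have hΦ : unfoldMap (ε k) x y ∉ K := fun h => hxK <|
        Metric.mem_cthickening_of_dist_le x _ 1 K h (by
          rw [dist_comm]
          exact ((hRε _ (hε k) x y hy).trans hk.le).trans (min_le_right _ _))
      simp only [Pi.sub_apply]
      rw [hψK _ hΦ, hψK _ hx0, sub_zero, norm_zero]
  refine ENNReal.tendsto_nhds_zero.2 fun r hr => ?_
  obtain ⟨η, hη, hηr⟩ : ∃ η : ℝ, 0 < η ∧ c * ENNReal.ofReal η ≤ r := by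
    rcases eq_or_ne r ⊤ with rfl | hrtop
    · exact ⟨1, one_pos, le_top⟩
    · have hrp : 0 < r.toReal := ENNReal.toReal_pos hr.ne' hrtop
      -- The summand 1 covers the case `c = 0`.
      refine ⟨r.toReal / (c.toReal + 1), by positivity, ?_⟩
      rw [← ENNReal.ofReal_toReal hctop, ← ENNReal.ofReal_mul ENNReal.toReal_nonneg]
      conv_rhs => rw [← ENNReal.ofReal_toReal hrtop]
      refine ENNReal.ofReal_le_ofReal ?_
      rw [ENNReal.toReal_ofReal ENNReal.toReal_nonneg, ← mul_div_assoc,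
        div_le_iff₀ (by positivity)]
      nlinarith [ENNReal.toReal_nonneg (a := c)]
  filter_upwards [key η hη] with k hk
  exact hk.trans hηr

end TestFunctions

/-! ### Weak convergence in Hilbert spaces. -/

section WeakConvergence

variable {H G : Type*} [NormedAddCommGroup H] [InnerProductSpace ℝ H]
  [NormedAddCommGroup G] [InnerProductSpace ℝ G]

/-- Weak convergence of a sequence in a real Hilbert space. -/
def WeakTendsto (z : ℕ → H) (z₀ : H) : Prop :=
  ∀ y, Tendsto (fun k => inner ℝ (z k) y) atTop (𝓝 (inner ℝ z₀ y))

lemma WeakTendsto.comp {z : ℕ → H} {z₀ : H} (h : WeakTendsto z z₀) {s : ℕ → ℕ}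
    (hs : StrictMono s) : WeakTendsto (fun k => z (s k)) z₀ :=
  fun y => (h y).comp hs.tendsto_atTop

lemma WeakTendsto.map [CompleteSpace H] [CompleteSpace G] {z : ℕ → H} {z₀ : H}
    (h : WeakTendsto z z₀) (T : H →L[ℝ] G) : WeakTendsto (fun k => T (z k)) (T z₀) := by
  intro y
  simp_rw [← ContinuousLinearMap.adjoint_inner_right]
  exact h _

lemma WeakTendsto.eq_of_tendsto {z : ℕ → H} {z₀ z₁ : H} (h : WeakTendsto z z₀)
    (h' : Tendsto z atTop (𝓝 z₁)) : z₀ = z₁ :=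
  ext_inner_right ℝ fun y => tendsto_nhds_unique (h y) (h'.inner tendsto_const_nhds)

lemma WeakTendsto.inner_tendsto {z y : ℕ → H} {z₀ y₀ : H} (h : WeakTendsto z z₀) {C : ℝ}
    (hC : ∀ k, ‖z k‖ ≤ C) (hy : Tendsto y atTop (𝓝 y₀)) :
    Tendsto (fun k => inner ℝ (z k) (y k)) atTop (𝓝 (inner ℝ z₀ y₀)) := by
  have h1 : Tendsto (fun k => inner ℝ (z k) (y k - y₀)) atTop (𝓝 0) := by
    refine squeeze_zero_norm (a := fun k => C * ‖y k - y₀‖) (fun k => ?_) ?_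
    · exact (norm_inner_le_norm _ _).trans (mul_le_mul_of_nonneg_right (hC k) (norm_nonneg _))
    · simpa using (tendsto_iff_norm_sub_tendsto_zero.1 hy).const_mul C
  simpa [inner_sub_right] using h1.add (h y₀)

/-- Sequential Banach–Alaoglu in the dual, carried back by the Riesz isomorphism. -/
lemma exists_weakTendsto_subseq [CompleteSpace H] [TopologicalSpace.SeparableSpace H]
    (z : ℕ → H) {C : ℝ} (hC : ∀ k, ‖z k‖ ≤ C) :
    ∃ s : ℕ → ℕ, StrictMono s ∧ ∃ z₀, WeakTendsto (fun k => z (s k)) z₀ := by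
  have hmem : ∀ k, WeakDual.toStrongDual.symm (InnerProductSpace.toDual ℝ H (z k)) ∈
      WeakDual.toStrongDual (𝕜 := ℝ) (E := H) ⁻¹' Metric.closedBall 0 C := by
    intro k
    simpa using hC k
  obtain ⟨φ, -, s, hs, hφ⟩ := WeakDual.isSeqCompact_closedBall ℝ H 0 C hmem
  refine ⟨s, hs, (InnerProductSpace.toDual ℝ H).symm (WeakDual.toStrongDual φ), fun y => ?_⟩
  have h := ((WeakDual.eval_continuous y).tendsto φ).comp hφ
  rw [InnerProductSpace.toDual_symm_apply]
  exact h

/-- The exceptional null set may depend on `y`. A countable dense subset of `A` gives a single null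
set, and orthogonality to a fixed vector is a closed condition. -/
lemma ae_forall_inner_eq_zero [TopologicalSpace.SeparableSpace H] {α : Type*} [MeasurableSpace α]
    {μ : Measure α} (A : Set H) (u : α → H) (h : ∀ y ∈ A, ∀ᵐ x ∂μ, inner ℝ (u x) y = 0) :
    ∀ᵐ x ∂μ, ∀ y ∈ A, inner ℝ (u x) y = 0 := by
  obtain ⟨t, htA, ht, hcl⟩ :=
    (TopologicalSpace.IsSeparable.of_separableSpace A).exists_countable_dense_subset
  filter_upwards [(ae_ball_iff ht).2 fun y hy => h y (htA hy)] with x hx y hy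
  have hclosed : IsClosed {y | inner ℝ (u x) y = 0} := isClosed_eq (by fun_prop) (by fun_prop)
  exact closure_minimal (t := {y | inner ℝ (u x) y = 0}) hx hclosed (hcl hy)

end WeakConvergence

/-! ### From weak convergence of unfoldings to two-scale convergence. -/

section TwoScaleLimits

variable {d : ℕ} {F : Type*} [NormedAddCommGroup F] [InnerProductSpace ℝ F]
  {Ω : Set (E d)}

/-- Functions on `Ω` are extended by zero before unfolding, so cells cut by the boundary need no
separate treatment. -/
lemma memLp_indicator_of_restrict {X : Type*} [NormedAddCommGroup X] {w : E d → X} {p : ℝ≥0∞} (hΩ : MeasurableSet Ω)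
    (hw : MemLp w p (volume.restrict Ω)) : MemLp (Ω.indicator w) p volume :=
  (memLp_indicator_iff_restrict hΩ).2 hw

instance [FiniteDimensional ℝ F] : TopologicalSpace.SeparableSpace (CellL2 d F) := by
  have : Fact ((2 : ℝ≥0∞) ≠ ⊤) := ⟨by simp⟩
  have := FiniteDimensional.proper_real F
  infer_instance

instance [FiniteDimensional ℝ F] : TopologicalSpace.SeparableSpace (UnfoldL2 d F) := by
  have : Fact ((2 : ℝ≥0∞) ≠ ⊤) := ⟨by simp⟩
  infer_instance

lemma IsTestFun.inner_toLp {ψ : E d → E d → F} (hψ : IsTestFun Ω ψ)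
    (z : UnfoldL2 d F) :
    inner ℝ z hψ.toLp = ∫ x in Ω, ∫ y in cell d, inner ℝ (z x y) (ψ x y) := by
  obtain ⟨K, -, hKΩ, hψK⟩ := hψ.2.2
  rw [setIntegral_eq_integral_of_forall_compl_eq_zero, L2.inner_def]
  · refine integral_congr_ae ?_
    filter_upwards [hψ.memLp_toFun.coeFn_toLp] with x hx
    rw [IsTestFun.toLp, hx, IsTestFun.toFun, L2.inner_def]
    refine integral_congr_ae ?_
    filter_upwards [(hψ.memLp_right x).coeFn_toLp] with y hy
    rw [hy]
  · intro x hx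
    simp [hψK x fun h => hx (hKΩ h)]

/-- Unfolding preserves inner products, so the oscillating integral pairs a bounded weakly
convergent sequence with a strongly convergent one. -/
lemma WeakTendsto.tendsto_setIntegral {w : ℕ → E d → F} {ε : ℕ → ℝ} (hε : ∀ k, 0 < ε k)
    (hε0 : Tendsto ε atTop (𝓝 0)) (hΩ : MeasurableSet Ω)
    (hw : ∀ k, MemLp (w k) 2 (volume.restrict Ω)) {C : ℝ}
    (hC : ∀ k, (eLpNorm (w k) 2 (volume.restrict Ω)).toReal ≤ C) {z : UnfoldL2 d F}
    (hz : WeakTendsto (fun k => unfoldLp (memLp_indicator_of_restrict hΩ (hw k)) (hε k)) z)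
    {ψ : E d → E d → F} (hψ : IsTestFun Ω ψ) :
    Tendsto (fun k => ∫ x in Ω, inner ℝ (w k x) (ψ x ((ε k)⁻¹ • x))) atTop
      (𝓝 (∫ x in Ω, ∫ y in cell d, inner ℝ (z x y) (ψ x y))) := by
  rw [← hψ.inner_toLp]
  have h := hz.inner_tendsto (C := C) (fun k => ?_) (hψ.tendsto_unfoldLp hε hε0)
  · refine h.congr fun k => ?_
    rw [inner_unfoldLp, ← integral_indicator hΩ]
    congr 1
    ext x
    by_cases hx : x ∈ Ω <;> simp [hx]
  · rw [norm_unfoldLp, eLpNorm_indicator_eq_eLpNorm_restrict hΩ]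
    exact hC k

lemma twoScaleConverges_of_weakTendsto {w : ℕ → E d → F} {ε : ℕ → ℝ} (hε : ∀ k, 0 < ε k)
    (hε0 : Tendsto ε atTop (𝓝 0)) (hΩ : MeasurableSet Ω)
    (hw : ∀ k, MemLp (w k) 2 (volume.restrict Ω)) {C : ℝ}
    (hC : ∀ k, (eLpNorm (w k) 2 (volume.restrict Ω)).toReal ≤ C) {z : UnfoldL2 d F}
    (hz : WeakTendsto (fun k => unfoldLp (memLp_indicator_of_restrict hΩ (hw k)) (hε k)) z) :
    TwoScaleConverges Ω ε w (fun x => z x) := by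
  refine ⟨hw, ⟨C.toNNReal, fun k => ?_⟩, (Lp.memLp z).restrict Ω,
    fun ψ hψ => hz.tendsto_setIntegral hε hε0 hΩ hw hC hψ⟩
  rw [← ENNReal.ofReal_toReal (hw k).2.ne]
  exact ENNReal.ofReal_le_ofReal (hC k)

end TwoScaleLimits

/-! ### Fourth order tensors, their square roots, and multiplication by periodic coefficients. -/

section Tensors

variable {d n : ℕ}

lemma act_add_right (a : Tens4 n d) (ζ η : Tens n d) : act a (ζ + η) = act a ζ + act a η :=
  (Matrix.toEuclideanCLM (𝕜 := ℝ) a).map_add ζ η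

lemma act_smul_right (a : Tens4 n d) (c : ℝ) (ζ : Tens n d) : act a (c • ζ) = c • act a ζ :=
  (Matrix.toEuclideanCLM (𝕜 := ℝ) a).map_smul c ζ

lemma act_zero_right (a : Tens4 n d) : act a 0 = 0 :=
  (Matrix.toEuclideanCLM (𝕜 := ℝ) a).map_zero

lemma act_add_left (a b : Tens4 n d) (ζ : Tens n d) : act (a + b) ζ = act a ζ + act b ζ := by
  ext p
  simp [act, Matrix.add_mulVec]

lemma act_smul_left (c : ℝ) (a : Tens4 n d) (ζ : Tens n d) : act (c • a) ζ = c • act a ζ := by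
  ext p
  simp [act, Matrix.smul_mulVec]

lemma act_apply (a : Tens4 n d) (ζ : Tens n d) (p : Fin n × Fin d) :
    act a ζ p = ∑ q, a p q * ζ q := rfl

lemma act_mul (a b : Tens4 n d) (ζ : Tens n d) : act (a * b) ζ = act a (act b ζ) := by
  ext p
  simp [act]

lemma inner_act_left {a : Tens4 n d} (ha : a.IsSymm) (ζ η : Tens n d) :
    inner ℝ (act a ζ) η = inner ℝ ζ (act a η) := by
  simp only [EuclideanSpace.inner_eq_star_dotProduct, act, star_trivial]
  rw [Matrix.dotProduct_mulVec, ← Matrix.mulVec_transpose, ha.eq, dotProduct_comm]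

lemma norm_act_le (a : Tens4 n d) (ζ : Tens n d) : ‖act a ζ‖ ≤ (∑ p, ∑ q, |a p q|) * ‖ζ‖ := by
  have h : act a ζ = ∑ p, (act a ζ p) • EuclideanSpace.single p (1 : ℝ) := by
    simpa using ((EuclideanSpace.basisFun (Fin n × Fin d) ℝ).sum_repr (act a ζ)).symm
  rw [h, Finset.sum_mul]
  refine (norm_sum_le _ _).trans (Finset.sum_le_sum fun p _ => ?_)
  rw [norm_smul, PiLp.norm_single, norm_one, mul_one, act_apply, Finset.sum_mul]
  refine (norm_sum_le _ _).trans (Finset.sum_le_sum fun q _ => ?_)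
  rw [norm_mul, Real.norm_eq_abs]
  exact mul_le_mul_of_nonneg_left (PiLp.norm_apply_le ζ q) (abs_nonneg _)

lemma abs_apply_le_norm_act (a : Tens4 n d) (p q : Fin n × Fin d) :
    |a p q| ≤ ‖act a (EuclideanSpace.single q 1)‖ := by
  have h : act a (EuclideanSpace.single q 1) p = a p q := by simp [act_apply]
  rw [← h]
  exact PiLp.norm_apply_le (act a (EuclideanSpace.single q 1)) p

section
open scoped Matrix.Norms.L2Operator

lemma continuousOn_tsqrt : ContinuousOn (tsqrt (n := n) (d := d)) {a | 0 ≤ a} :=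
  CFC.continuousOn_sqrt

end

lemma tsqrt_mul_self {a : Tens4 n d} (ha : a.PosSemidef) : tsqrt a * tsqrt a = a :=
  CFC.sqrt_mul_sqrt_self a ha.nonneg

lemma tsqrt_isSymm (a : Tens4 n d) : (tsqrt a).IsSymm := by
  have h : 0 ≤ tsqrt a := CFC.sqrt_nonneg a
  have := (Matrix.nonneg_iff_posSemidef.1 h).isHermitian
  simpa [Matrix.IsHermitian, Matrix.IsSymm] using this

lemma posSemidef_of_inner_act {a : Tens4 n d} (hs : a.IsSymm)
    (h : ∀ ζ : Tens n d, 0 ≤ inner ℝ (act a ζ) ζ) : a.PosSemidef := by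
  refine Matrix.PosSemidef.of_dotProduct_mulVec_nonneg ?_ fun x => ?_
  · simpa [Matrix.IsHermitian, Matrix.IsSymm] using hs
  · have := h (WithLp.toLp 2 x)
    simpa [EuclideanSpace.inner_eq_star_dotProduct, act] using this

lemma norm_sq_act_tsqrt {a : Tens4 n d} (ha : a.PosSemidef) (ζ : Tens n d) :
    ‖act (tsqrt a) ζ‖ ^ 2 = inner ℝ (act a ζ) ζ := by
  rw [← real_inner_self_eq_norm_sq, ← inner_act_left (tsqrt_isSymm a), ← act_mul,
    tsqrt_mul_self ha]

lemma norm_act_tsqrt_le {a : Tens4 n d} (ha : a.PosSemidef) {C : ℝ}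
    (hC : ∀ ζ, ‖act a ζ‖ ≤ C * ‖ζ‖) (ζ : Tens n d) : ‖act (tsqrt a) ζ‖ ≤ √C * ‖ζ‖ := by
  have h : ‖act (tsqrt a) ζ‖ ^ 2 ≤ C * ‖ζ‖ ^ 2 := by
    rw [norm_sq_act_tsqrt ha]
    refine (real_inner_le_norm _ _).trans ?_
    rw [pow_two, ← mul_assoc]
    exact mul_le_mul_of_nonneg_right (hC ζ) (norm_nonneg _)
  rw [← Real.sqrt_sq (norm_nonneg ζ), ← Real.sqrt_mul' _ (sq_nonneg _)]
  exact Real.le_sqrt_of_sq_le h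

/-- `a ∈ (L^∞_#(Q))^{n×d×n×d}`. -/
def LinftyPerTens (a : E d → Tens4 n d) : Prop := ∀ p q, LinftyPer (fun y => a y p q)

variable {a : E d → Tens4 n d}

lemma memLp_act_of_entries {α : Type*} [MeasurableSpace α] {μ : Measure α} {b : α → Tens4 n d}
    (hb : ∀ p q, MemLp (fun y => b y p q) ⊤ μ) {g : α → Tens n d} (hg : MemLp g 2 μ) :
    MemLp (fun y => act (b y) (g y)) 2 μ := by
  refine memLp_piLp_iff.2 fun p => ?_
  simp only [act_apply]
  exact memLp_finsetSum _ fun q _ => (memLp_piLp_iff.1 hg q).mul (hb p q)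

lemma LinftyPerTens.memLp_smul (ha : LinftyPerTens a) {ε : ℝ} (hε : 0 < ε) (Ω : Set (E d))
    (p q : Fin n × Fin d) : MemLp (fun x => a (ε⁻¹ • x) p q) ⊤ (volume.restrict Ω) :=
  (memLp_comp_smul (ha p q).2 (inv_pos.2 hε)).restrict Ω

lemma LinftyPerTens.memLp_act_smul (ha : LinftyPerTens a) {ε : ℝ} (hε : 0 < ε) {Ω : Set (E d)}
    {g : E d → Tens n d} (hg : MemLp g 2 (volume.restrict Ω)) :
    MemLp (fun x => act (a (ε⁻¹ • x)) (g x)) 2 (volume.restrict Ω) :=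
  memLp_act_of_entries (ha.memLp_smul hε Ω) hg

lemma LinftyPerTens.memLp_act (ha : LinftyPerTens a) {Ω : Set (E d)} {g : E d → Tens n d}
    (hg : MemLp g 2 (volume.restrict Ω)) :
    MemLp (fun x => act (a x) (g x)) 2 (volume.restrict Ω) :=
  memLp_act_of_entries (fun p q => (ha p q).2.restrict Ω) hg

lemma LinftyPer.exists_bound {g : E d → ℝ} (hg : LinftyPer g) :
    ∃ C, 0 ≤ C ∧ ∀ᵐ y, |g y| ≤ C := by
  refine ⟨(eLpNormEssSup g volume).toReal, ENNReal.toReal_nonneg, ?_⟩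
  have hfin : eLpNormEssSup g volume ≠ ⊤ := by
    have := hg.2.2.ne
    rwa [eLpNorm_exponent_top] at this
  filter_upwards [ae_le_eLpNormEssSup (f := g) (μ := volume)] with y hy
  rw [← Real.norm_eq_abs, ← toReal_enorm]
  exact ENNReal.toReal_mono hfin hy

lemma LinftyPerTens.exists_bound (ha : LinftyPerTens a) :
    ∃ C, 0 ≤ C ∧ ∀ᵐ y, ∀ ζ, ‖act (a y) ζ‖ ≤ C * ‖ζ‖ := by
  choose c hc0 hc using fun p q => (ha p q).exists_bound
  refine ⟨∑ p, ∑ q, c p q, Finset.sum_nonneg fun p _ => Finset.sum_nonneg fun q _ => hc0 p q, ?_⟩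
  filter_upwards [ae_all_iff.2 fun p => ae_all_iff.2 fun q => hc p q] with y hy ζ
  refine (norm_act_le _ _).trans (mul_le_mul_of_nonneg_right ?_ (norm_nonneg _))
  exact Finset.sum_le_sum fun p _ => Finset.sum_le_sum fun q _ => hy p q

lemma LinftyPerTens.apply_add_latticeVec (ha : LinftyPerTens a) (k : Fin d → ℤ) (y : E d) :
    a (latticeVec k + y) = a y := by
  ext p q
  exact TwoScale.apply_add_latticeVec (ha p q).1 k y

/-- Periodicity is inherited pointwise and the bound is `norm_act_tsqrt_le`. Measurability is the
delicate point, since continuity of the root is known only on the closed cone of non-negative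
matrices. -/
lemma LinftyPerTens.tsqrt (ha : LinftyPerTens a) (hpos : ∀ᵐ y, (a y).PosSemidef) :
    LinftyPerTens (fun y => tsqrt (a y)) := by
  classical
  intro p q
  refine ⟨fun k y => ?_, ?_⟩
  · have := ha.apply_add_latticeVec k y
    rw [add_comm] at this
    exact congrArg (fun b : Tens4 n d => TwoScale.tsqrt b p q) this
  let S : Set (Fin n × Fin d → Fin n × Fin d → ℝ) :=
    {b | 0 ≤ (Matrix.of b : Tens4 n d)}
  have hS : IsClosed S := by
    have : IsClosed {b : Tens4 n d | 0 ≤ b} := by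
      simp only [Matrix.nonneg_iff_posSemidef]
      have h : {b : Tens4 n d | b.PosSemidef} =
          {b | bᵀ = b} ∩ ⋂ x : Fin n × Fin d → ℝ, {b | 0 ≤ x ⬝ᵥ b *ᵥ x} := by
        ext b
        simp only [Set.mem_ofPred_eq, Set.mem_inter_iff, Set.mem_iInter,
          Matrix.posSemidef_iff_dotProduct_mulVec, Matrix.IsHermitian, star_trivial,
          Matrix.conjTranspose_eq_transpose_of_trivial]
      rw [h]
      refine (isClosed_eq (by fun_prop) (by fun_prop)).inter (isClosed_iInter fun x => ?_)
      exact isClosed_le continuous_const (by fun_prop)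
    exact this
  let f : (Fin n × Fin d → Fin n × Fin d → ℝ) → ℝ :=
    fun b => TwoScale.tsqrt (Matrix.of b : Tens4 n d) p q
  have hf : ContinuousOn f S := by
    have h1 : ContinuousOn (TwoScale.tsqrt (n := n) (d := d)) {a | 0 ≤ a} := continuousOn_tsqrt
    have h2 : Continuous fun b : Tens4 n d => b p q := by fun_prop
    exact h2.comp_continuousOn h1
  -- Extending the root by 0 off the closed cone gives a globally measurable function; the value 0
  -- is irrelevant because `a y` lies in the cone for almost every `y`.
  have hm : Measurable (S.piecewise f (fun _ => 0)) :=
    hf.measurable_piecewise continuousOn_const hS.measurableSet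
  have ham : AEMeasurable (fun y p q => a y p q) (volume : Measure (E d)) :=
    aemeasurable_pi_lambda _ fun p => aemeasurable_pi_lambda _ fun q => (ha p q).2.1.aemeasurable
  have hmeas : AEStronglyMeasurable (fun y => TwoScale.tsqrt (a y) p q) volume := by
    refine ((hm.comp_aemeasurable ham).congr ?_).aestronglyMeasurable
    filter_upwards [hpos] with y hy
    have hyS : (fun p q => a y p q) ∈ S := hy.nonneg
    simp only [Function.comp_apply]
    rw [Set.piecewise_eq_of_mem _ _ _ hyS]
    rfl
  obtain ⟨C, hC0, hC⟩ := ha.exists_bound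
  refine memLp_top_of_bound hmeas (√C) ?_
  filter_upwards [hC, hpos] with y hy hy'
  refine (abs_apply_le_norm_act _ p q).trans ((norm_act_tsqrt_le hy' hy _).trans ?_)
  rw [PiLp.norm_single, norm_one, mul_one]

/-- Multiplication by a bounded periodic tensor, as an operator on `L²(Q)^{n×d}`. -/
def LinftyPerTens.cellAct (ha : LinftyPerTens a) : CellL2 d (Tens n d) →L[ℝ] CellL2 d (Tens n d) :=
  LinearMap.mkContinuousOfExistsBound
    { toFun := fun g => (ha.memLp_act (Lp.memLp g)).toLp
      map_add' := by
        intro f g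
        rw [← MemLp.toLp_add]
        refine MemLp.toLp_congr _ _ ?_
        filter_upwards [Lp.coeFn_add f g] with y hy
        change act (a y) ((f + g : CellL2 d (Tens n d)) y) = _
        rw [hy]
        exact act_add_right _ _ _
      map_smul' := by
        intro c f
        rw [RingHom.id_apply, ← MemLp.toLp_const_smul]
        refine MemLp.toLp_congr _ _ ?_
        filter_upwards [Lp.coeFn_smul c f] with y hy
        change act (a y) ((c • f : CellL2 d (Tens n d)) y) = _
        rw [hy]
        exact act_smul_right _ _ _ }
    (by
      obtain ⟨C, -, hC⟩ := ha.exists_bound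
      refine ⟨C, fun g => Lp.norm_le_mul_norm_of_ae_le_mul ?_⟩
      filter_upwards [(ha.memLp_act (Lp.memLp g)).coeFn_toLp, ae_restrict_of_ae hC] with y h1 h2
      simp only [LinearMap.coe_mk, AddHom.coe_mk]
      rw [h1]
      exact h2 _)

lemma LinftyPerTens.coeFn_cellAct (ha : LinftyPerTens a) (g : CellL2 d (Tens n d)) :
    ha.cellAct g =ᵐ[volume.restrict (cell d)] fun y => act (a y) (g y) :=
  MemLp.coeFn_toLp (ha.memLp_act (Lp.memLp g))

/-- Multiplication by a bounded periodic tensor, as an operator on `L²(ℝ^d; L²(Q)^{n×d})`. -/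
def LinftyPerTens.unfoldAct (ha : LinftyPerTens a) :
    UnfoldL2 d (Tens n d) →L[ℝ] UnfoldL2 d (Tens n d) :=
  ContinuousLinearMap.compLpL 2 volume ha.cellAct

lemma LinftyPerTens.coeFn_unfoldAct (ha : LinftyPerTens a) (z : UnfoldL2 d (Tens n d)) :
    ha.unfoldAct z =ᵐ[volume] fun x => ha.cellAct (z x) :=
  ContinuousLinearMap.coeFn_compLpL _ _

/-- Under unfolding `x/ε` becomes a lattice vector plus `y`, so the oscillating coefficient turns
into an operator independent of `ε`, through which weak limits pass. -/
lemma LinftyPerTens.unfoldAct_unfoldLp (ha : LinftyPerTens a) {Ω : Set (E d)}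
    (hΩ : MeasurableSet Ω) {g : E d → Tens n d} (hg : MemLp g 2 (volume.restrict Ω)) {ε : ℝ}
    (hε : 0 < ε) :
    ha.unfoldAct (unfoldLp (memLp_indicator_of_restrict hΩ hg) hε)
      = unfoldLp (memLp_indicator_of_restrict hΩ (ha.memLp_act_smul hε hg)) hε := by
  refine Lp.ext ?_
  filter_upwards [ha.coeFn_unfoldAct (unfoldLp (memLp_indicator_of_restrict hΩ hg) hε),
    coeFn_unfoldLp (memLp_indicator_of_restrict hΩ hg) hε,
    coeFn_unfoldLp (memLp_indicator_of_restrict hΩ (ha.memLp_act_smul hε hg)) hε] with x h1 h2 h3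
  rw [h1, h2, h3]
  refine Lp.ext ?_
  filter_upwards [ha.coeFn_cellAct (unfold ε (Ω.indicator g) x),
    coeFn_unfold (memLp_indicator_of_restrict hΩ hg) hε x,
    coeFn_unfold (memLp_indicator_of_restrict hΩ (ha.memLp_act_smul hε hg)) hε x] with y k1 k2 k3
  rw [k1, k2, k3]
  by_cases h : unfoldMap ε x y ∈ Ω
  · rw [Set.indicator_of_mem h, Set.indicator_of_mem h, inv_smul_unfoldMap hε,
      ha.apply_add_latticeVec]
  · rw [Set.indicator_of_notMem h, Set.indicator_of_notMem h, act_zero_right]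

end Tensors

/-! ### Fourier series on the periodicity cell, and orthogonality to periodic gradients. -/

section Fourier

variable {d n : ℕ}

-- The normalised Haar measure, for which the Fourier monomials are orthonormal.
local instance unitAddCircleMeasureSpace : MeasureSpace UnitAddCircle :=
  ⟨AddCircle.haarAddCircle⟩

/-- The representative in `(0,1]^d` of a point of the torus. -/
def torusLift (t : UnitAddTorus (Fin d)) : E d :=
  WithLp.toLp 2 (fun i => ((AddCircle.equivIoc 1 0 (t i)).1 : ℝ))

lemma coe_torusLift (t : UnitAddTorus (Fin d)) (i : Fin d) :
    ((torusLift t i : ℝ) : UnitAddCircle) = t i :=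
  (AddCircle.equivIoc 1 0).symm_apply_apply (t i)

lemma measurePreserving_torusLift :
    MeasurePreserving (torusLift (d := d)) volume (volume.restrict (cell d)) := by
  let C : Set (Fin d → ℝ) := {x | ∀ i, x i ∈ Set.Ioc ((0 : Fin d → ℝ) i) ((0 : Fin d → ℝ) i + 1)}
  have hC : MeasurableSet C := MeasurableSet.univ_pi' fun i => measurableSet_Ioc
  have h1 := UnitAddTorus.measurePreserving_equivPiIoc (0 : Fin d → ℝ)
  have h2 : MeasurePreserving (Subtype.val : C → Fin d → ℝ)
      (Measure.comap Subtype.val volume) (volume.restrict C) :=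
    ⟨measurable_subtype_coe, map_comap_subtype_coe hC _⟩
  have h3 : MeasurePreserving (WithLp.toLp 2 : (Fin d → ℝ) → E d) volume volume :=
    PiLp.volume_preserving_toLp (Fin d)
  have h4 : (WithLp.toLp 2 : (Fin d → ℝ) → E d) ⁻¹' cell d =ᵐ[volume] C := by
    have e1 : (WithLp.toLp 2 : (Fin d → ℝ) → E d) ⁻¹' cell d
        = Set.Icc (fun _ : Fin d => (0 : ℝ)) fun _ => 1 := by
      ext y
      simp [cell, Pi.le_def, forall_and]
    have e2 : C = Set.univ.pi fun _ : Fin d => Set.Ioc (0 : ℝ) 1 := by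
      ext y
      simp [C]
    rw [e1, e2]
    exact (Measure.univ_pi_Ioc_ae_eq_Icc (μ := fun _ : Fin d => (volume : Measure ℝ))
      (f := fun _ => (0 : ℝ)) (g := fun _ => 1)).symm
  have h5 := h3.restrict_preimage (measurableSet_cell (d := d))
  rw [Measure.restrict_congr_set h4] at h5
  exact h5.comp (h2.comp h1)

/-- The phase `2π k·y`. -/
def phase (k : Fin d → ℤ) (y : E d) : ℝ := 2 * Real.pi * ∑ i, (k i : ℝ) * y i

lemma mFourier_neg_eq (k : Fin d → ℤ) (t : UnitAddTorus (Fin d)) :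
    UnitAddTorus.mFourier (-k) t
      = Real.cos (phase k (torusLift t)) - Real.sin (phase k (torusLift t)) * Complex.I := by
  have h : UnitAddTorus.mFourier (-k) t = Complex.exp (((-phase k (torusLift t) : ℝ)) * Complex.I) := by
    rw [UnitAddTorus.mFourier, ContinuousMap.coe_mk]
    have : ∀ i, fourier ((-k) i) (t i)
        = Complex.exp ((-(2 * Real.pi * (k i * torusLift t i)) : ℝ) * Complex.I) := by
      intro i
      rw [← coe_torusLift t i, fourier_coe_apply]
      congr 1
      push_cast [Pi.neg_apply]
      ring
    simp_rw [this]
    rw [← Complex.exp_sum, phase, Finset.mul_sum]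
    congr 1
    push_cast
    rw [← Finset.sum_neg_distrib, Finset.sum_mul]
  rw [h, Complex.exp_mul_I, ← Complex.ofReal_cos, ← Complex.ofReal_sin, Real.cos_neg, Real.sin_neg]
  push_cast
  ring

/-- Cosine coefficient of a function on the periodicity cell. -/
def cosCoeff (k : Fin d → ℤ) (f : E d → ℝ) : ℝ := ∫ y in cell d, Real.cos (phase k y) * f y

/-- Sine coefficient of a function on the periodicity cell. -/
def sinCoeff (k : Fin d → ℤ) (f : E d → ℝ) : ℝ := ∫ y in cell d, Real.sin (phase k y) * f y

lemma contDiff_phase (k : Fin d → ℤ) : ContDiff ℝ ∞ (phase k) := by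
  unfold phase
  fun_prop

lemma integrable_of_memLp_cell {f : E d → ℝ} (hf : MemLp f 2 (volume.restrict (cell d))) :
    Integrable f (volume.restrict (cell d)) := hf.integrable one_le_two

lemma integrable_cos_mul (k : Fin d → ℤ) {f : E d → ℝ}
    (hf : MemLp f 2 (volume.restrict (cell d))) :
    Integrable (fun y => Real.cos (phase k y) * f y) (volume.restrict (cell d)) :=
  (integrable_of_memLp_cell hf).bdd_mul (c := 1)
    (Real.continuous_cos.comp (contDiff_phase k).continuous).aestronglyMeasurable
    (Eventually.of_forall fun _ => Real.abs_cos_le_one _)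

lemma integrable_sin_mul (k : Fin d → ℤ) {f : E d → ℝ}
    (hf : MemLp f 2 (volume.restrict (cell d))) :
    Integrable (fun y => Real.sin (phase k y) * f y) (volume.restrict (cell d)) :=
  (integrable_of_memLp_cell hf).bdd_mul (c := 1)
    (Real.continuous_sin.comp (contDiff_phase k).continuous).aestronglyMeasurable
    (Eventually.of_forall fun _ => Real.abs_sin_le_one _)

lemma mFourierCoeff_torusLift {f : E d → ℝ} (hf : MemLp f 2 (volume.restrict (cell d)))
    (k : Fin d → ℤ) :
    UnitAddTorus.mFourierCoeff (fun t => ((f (torusLift t) : ℝ) : ℂ)) k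
      = cosCoeff k f - sinCoeff k f * Complex.I := by
  have hm := measurePreserving_torusLift (d := d)
  have hc := integrable_cos_mul k hf
  have hs := integrable_sin_mul k hf
  have hci : Integrable (fun y => ((Real.cos (phase k y) * f y : ℝ) : ℂ))
    (volume.restrict (cell d)) := hc.ofReal
  have hsi : Integrable (fun y => ((Real.sin (phase k y) * f y : ℝ) : ℂ) * Complex.I)
    (volume.restrict (cell d)) := hs.ofReal.mul_const _
  rw [UnitAddTorus.mFourierCoeff, cosCoeff, sinCoeff, ← integral_complex_ofReal,
    ← integral_complex_ofReal, ← integral_mul_const, ← integral_sub hci hsi, ← hm.map_eq,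
    integral_map hm.measurable.aemeasurable]
  · congr 1
    ext t
    rw [mFourier_neg_eq, smul_eq_mul]
    push_cast
    ring
  · rw [hm.map_eq]
    exact (hci.sub hsi).1

/-- Parseval's identity on the complex torus; the k-th term is the real part of `conj(c_f - i
s_f)(c_g - i s_g)`. -/
lemma hasSum_coeff_mul {f g : E d → ℝ} (hf : MemLp f 2 (volume.restrict (cell d)))
    (hg : MemLp g 2 (volume.restrict (cell d))) :
    HasSum (fun k => cosCoeff k f * cosCoeff k g + sinCoeff k f * sinCoeff k g)
      (∫ y in cell d, f y * g y) := by
  have hm := measurePreserving_torusLift (d := d)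
  have hF : MemLp (fun t => ((f (torusLift t) : ℝ) : ℂ)) 2 volume :=
    (hf.comp_measurePreserving hm).ofReal
  have hG : MemLp (fun t => ((g (torusLift t) : ℝ) : ℂ)) 2 volume :=
    (hg.comp_measurePreserving hm).ofReal
  have h := UnitAddTorus.hasSum_prod_mFourierCoeff hF.toLp hG.toLp
  have hcoef : ∀ {f : E d → ℝ} (hF : MemLp (fun t => ((f (torusLift t) : ℝ) : ℂ)) 2 volume) k,
      UnitAddTorus.mFourierCoeff (hF.toLp) k
        = UnitAddTorus.mFourierCoeff (fun t => ((f (torusLift t) : ℝ) : ℂ)) k := by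
    intro f hF k
    refine integral_congr_ae ?_
    filter_upwards [hF.coeFn_toLp] with t ht
    rw [ht]
  have hint : ∫ t, (starRingEnd ℂ) (hF.toLp _ t) * hG.toLp _ t
      = ((∫ y in cell d, f y * g y : ℝ) : ℂ) := by
    rw [← hm.map_eq, integral_map hm.measurable.aemeasurable, ← integral_complex_ofReal]
    · refine integral_congr_ae ?_
      filter_upwards [hF.coeFn_toLp, hG.coeFn_toLp] with t h1 h2
      rw [h1, h2, Complex.conj_ofReal, Complex.ofReal_mul]
    · rw [hm.map_eq]
      exact hf.1.mul hg.1
  rw [hint] at h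
  simp_rw [hcoef, mFourierCoeff_torusLift hf, mFourierCoeff_torusLift hg] at h
  have h' := Complex.hasSum_re h
  simpa using h'

lemma phase_add (k m : Fin d → ℤ) (y : E d) :
    phase k (y + WithLp.toLp 2 (fun i => (m i : ℝ)))
      = phase k y + (∑ i, k i * m i : ℤ) * (2 * Real.pi) := by
  simp only [phase, PiLp.add_apply, mul_add, Finset.sum_add_distrib]
  push_cast
  ring

lemma qPeriodic_cos (k : Fin d → ℤ) : QPeriodic (fun y : E d => Real.cos (phase k y)) := by
  intro m y
  simp only [phase_add, Real.cos_add_int_mul_two_pi]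

lemma qPeriodic_sin (k : Fin d → ℤ) : QPeriodic (fun y : E d => Real.sin (phase k y)) := by
  intro m y
  simp only [phase_add, Real.sin_add_int_mul_two_pi]

lemma fderiv_phase (k : Fin d → ℤ) (y : E d) (j : Fin d) :
    fderiv ℝ (phase k) y (EuclideanSpace.single j 1) = 2 * Real.pi * k j := by
  let L : E d →L[ℝ] ℝ := (2 * Real.pi) • ∑ i, (k i : ℝ) • EuclideanSpace.proj i
  have : phase k = L := by
    ext y
    simp [phase, L]
  rw [this, L.fderiv]
  simp [L, Finset.sum_ite_eq']

lemma fderiv_cos_phase (k : Fin d → ℤ) (y : E d) (j : Fin d) :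
    fderiv ℝ (fun y => Real.cos (phase k y)) y (EuclideanSpace.single j 1)
      = -(2 * Real.pi * k j) * Real.sin (phase k y) := by
  have hd : DifferentiableAt ℝ (phase k) y :=
    (contDiff_phase k).differentiable (by simp) y
  rw [fderiv_cos hd]
  simp [fderiv_phase]
  ring

lemma fderiv_sin_phase (k : Fin d → ℤ) (y : E d) (j : Fin d) :
    fderiv ℝ (fun y => Real.sin (phase k y)) y (EuclideanSpace.single j 1)
      = (2 * Real.pi * k j) * Real.cos (phase k y) := by
  have hd : DifferentiableAt ℝ (phase k) y :=
    (contDiff_phase k).differentiable (by simp) y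
  rw [fderiv_sin hd]
  simp [fderiv_phase]
  ring

/-- Trigonometric functions are admissible in the definition of the weak gradient, so gradient
coefficients are multiples of `k j`. -/
lemma cosCoeff_snd {w : GraphSpace n (cell d)} (hw : w ∈ H1per d n) (k : Fin d → ℤ) (i : Fin n)
    (j : Fin d) : cosCoeff k (fun y => w.snd y (i, j))
      = 2 * Real.pi * k j * sinCoeff k (fun y => w.fst y i) := by
  have h := hw (fun y => Real.cos (phase k y)) ((contDiff_phase k).cos) (qPeriodic_cos k) i j
  simp only [fderiv_cos_phase] at h
  rw [cosCoeff, sinCoeff, ← integral_const_mul]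
  rw [← neg_eq_iff_eq_neg, ← integral_neg] at h
  simp only [mul_comm (Real.cos _)]
  rw [← h]
  congr 1
  ext y
  ring

lemma sinCoeff_snd {w : GraphSpace n (cell d)} (hw : w ∈ H1per d n) (k : Fin d → ℤ) (i : Fin n)
    (j : Fin d) : sinCoeff k (fun y => w.snd y (i, j))
      = -(2 * Real.pi * k j * cosCoeff k (fun y => w.fst y i)) := by
  have h := hw (fun y => Real.sin (phase k y)) ((contDiff_phase k).sin) (qPeriodic_sin k) i j
  simp only [fderiv_sin_phase] at h
  rw [cosCoeff, sinCoeff, ← integral_const_mul]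
  simp only [mul_comm (Real.sin _)]
  rw [eq_neg_iff_add_eq_zero, add_comm, ← eq_neg_iff_add_eq_zero, ← h]
  congr 1
  ext y
  ring

lemma grad_smul_single {g : E d → ℝ} (hg : Differentiable ℝ g) (i : Fin n) (y : E d)
    (p : Fin n × Fin d) :
    grad (fun y => g y • (EuclideanSpace.single i 1 : E n)) y p
      = if p.1 = i then fderiv ℝ g y (EuclideanSpace.single p.2 1) else 0 := by
  simp only [grad]
  rw [fderiv_smul_const (hg y)]
  simp

lemma integral_inner_grad_smul_single (η : E d → Tens n d)
    (hη : MemLp η 2 (volume.restrict (cell d))) {g : E d → ℝ} (hg : Differentiable ℝ g)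
    (i : Fin n) {c : Fin d → ℝ} {h : E d → ℝ}
    (hh : ∀ f, MemLp f 2 (volume.restrict (cell d)) →
      Integrable (fun y => h y * f y) (volume.restrict (cell d)))
    (hd : ∀ y j, fderiv ℝ g y (EuclideanSpace.single j 1) = c j * h y) :
    ∫ y in cell d, inner ℝ (η y) (grad (fun y => g y • (EuclideanSpace.single i 1 : E n)) y)
      = ∑ j, c j * ∫ y in cell d, h y * η y (i, j) := by
  simp_rw [← integral_const_mul]
  rw [← integral_finsetSum]
  · congr 1
    ext y
    simp only [PiLp.inner_apply, grad_smul_single hg, hd, Fintype.sum_prod_type]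
    rw [Finset.sum_eq_single i]
    · simp
      refine Finset.sum_congr rfl fun j _ => ?_
      ring
    · intro b _ hb
      simp [hb]
    · simp
  · intro j _
    exact (hh _ (memLp_piLp_iff.1 hη (i, j))).const_mul _

/-- A field orthogonal to the gradients of smooth periodic functions is orthogonal to the
gradients of all periodic `H¹` functions. -/
lemma integral_inner_snd_eq_zero {η : E d → Tens n d} (hη : MemLp η 2 (volume.restrict (cell d)))
    (h : ∀ φ : E d → E n, ContDiff ℝ ∞ φ → QPeriodic φ →
      ∫ y in cell d, inner ℝ (η y) (grad φ y) = 0)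
    {w : GraphSpace n (cell d)} (hw : w ∈ H1per d n) :
    ∫ y in cell d, inner ℝ (η y) (w.snd y) = 0 := by
  -- Testing with sines makes the cosine coefficients of each row of `η` orthogonal to `k`; testing
  -- with cosines does the same for the sine coefficients.
  have hcos : ∀ k i, ∑ j, (2 * Real.pi * k j) * cosCoeff k (fun y => η y (i, j)) = 0 := by
    intro k i
    rw [← h (fun y => Real.sin (phase k y) • (EuclideanSpace.single i 1 : E n))
        ((contDiff_phase k).sin.smul contDiff_const) ?_,
      integral_inner_grad_smul_single η hη ((contDiff_phase k).sin.differentiable (by simp)) i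
        (fun f hf => integrable_cos_mul k hf) (fun y j => fderiv_sin_phase k y j)]
    · rfl
    · intro m y
      exact congrArg (· • _) (qPeriodic_sin k m y)
  have hsin : ∀ k i, ∑ j, (2 * Real.pi * k j) * sinCoeff k (fun y => η y (i, j)) = 0 := by
    intro k i
    rw [← neg_eq_zero, ← Finset.sum_neg_distrib]
    rw [← h (fun y => Real.cos (phase k y) • (EuclideanSpace.single i 1 : E n))
        ((contDiff_phase k).cos.smul contDiff_const) ?_,
      integral_inner_grad_smul_single η hη ((contDiff_phase k).cos.differentiable (by simp)) i
        (fun f hf => integrable_sin_mul k hf) (fun y j => fderiv_cos_phase k y j)]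
    · simp only [neg_mul, sinCoeff]
    · intro m y
      exact congrArg (· • _) (qPeriodic_cos k m y)
  have hη' := memLp_piLp_iff.1 hη
  have hg' := memLp_piLp_iff.1 (Lp.memLp w.snd)
  have hsplit : ∫ y in cell d, inner ℝ (η y) (w.snd y)
      = ∑ i, ∑ j, ∫ y in cell d, η y (i, j) * w.snd y (i, j) := by
    rw [← Fintype.sum_prod_type' (f := fun i j => ∫ y in cell d, η y (i, j) * w.snd y (i, j)),
      ← integral_finsetSum]
    · congr 1
      ext y
      simp only [PiLp.inner_apply, RCLike.inner_apply, conj_trivial]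
      refine Finset.sum_congr rfl fun p _ => mul_comm _ _
    · exact fun p _ => (hη' p).integrable_mul (hg' p)
  have hsum := hasSum_sum (s := Finset.univ) fun i (_ : i ∈ Finset.univ) =>
    hasSum_sum (s := Finset.univ) fun j (_ : j ∈ Finset.univ) =>
      hasSum_coeff_mul (hη' (i, j)) (hg' (i, j))
  rw [hsplit]
  -- The gradient of `w` has coefficients proportional to `k`, those of `η` are orthogonal to `k`,
  -- so every Parseval term vanishes.
  refine hsum.unique ?_
  convert hasSum_zero using 2 with k
  refine Finset.sum_eq_zero fun i _ => ?_
  have e1 := hcos k i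
  have e2 := hsin k i
  simp_rw [cosCoeff_snd hw, sinCoeff_snd hw]
  calc ∑ j, (cosCoeff k (fun y => η y (i, j)) * (2 * Real.pi * k j * sinCoeff k fun y => w.fst y i)
        + sinCoeff k (fun y => η y (i, j)) * -(2 * Real.pi * k j * cosCoeff k fun y => w.fst y i))
      = (∑ j, (2 * Real.pi * k j) * cosCoeff k (fun y => η y (i, j)))
            * (sinCoeff k fun y => w.fst y i)
        - (∑ j, (2 * Real.pi * k j) * sinCoeff k (fun y => η y (i, j)))
            * (cosCoeff k fun y => w.fst y i) := by
        rw [Finset.sum_mul, Finset.sum_mul, ← Finset.sum_sub_distrib]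
        refine Finset.sum_congr rfl fun j _ => ?_
        ring
    _ = 0 := by rw [e1, e2]; ring

end Fourier

/-! ### Gårding's inequality by the Fourier transform. -/

section Garding

open scoped FourierTransform LineDeriv SchwartzMap

variable {d n : ℕ}

lemma differentiable_of_smooth {X Y : Type*} [NormedAddCommGroup X] [NormedSpace ℝ X]
    [NormedAddCommGroup Y] [NormedSpace ℝ Y] {φ : X → Y} (hφ : ContDiff ℝ ∞ φ) :
    Differentiable ℝ φ := hφ.differentiable (by simp)

lemma grad_apply (φ : E d → E n) (x : E d) (p : Fin n × Fin d) :
    grad φ x p = fderiv ℝ φ x (EuclideanSpace.single p.2 1) p.1 := rfl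

lemma fderiv_component {φ : E d → E n} (hφ : Differentiable ℝ φ) (i : Fin n) (x v : E d) :
    fderiv ℝ (fun x => φ x i) x v = fderiv ℝ φ x v i := by
  have h := ((EuclideanSpace.proj (𝕜 := ℝ) i).hasFDerivAt.comp x (hφ x).hasFDerivAt).fderiv
  exact congrArg (fun L => L v) h

/-- A component of a smooth compactly supported function as a complex Schwartz function. -/
def schwartzComponent {φ : E d → E n} (hφ : ContDiff ℝ ∞ φ) (hc : HasCompactSupport φ)
    (i : Fin n) : 𝓢(E d, ℂ) :=
  HasCompactSupport.toSchwartzMap (f := fun x => ((φ x i : ℝ) : ℂ))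
    (hc.comp_left (g := fun v : E n => ((v i : ℝ) : ℂ)) (by simp))
    (Complex.ofRealCLM.contDiff.comp ((EuclideanSpace.proj (𝕜 := ℝ) i).contDiff.comp hφ))

lemma lineDeriv_schwartzComponent {φ : E d → E n} (hφ : ContDiff ℝ ∞ φ)
    (hc : HasCompactSupport φ) (p : Fin n × Fin d) (x : E d) :
    (∂_{(EuclideanSpace.single p.2 1 : E d)} (schwartzComponent hφ hc p.1)) x
      = ((grad φ x p : ℝ) : ℂ) := by
  have hd := differentiable_of_smooth hφ
  rw [SchwartzMap.lineDerivOp_apply_eq_fderiv]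
  have h : HasFDerivAt (fun x => ((φ x p.1 : ℝ) : ℂ))
      (Complex.ofRealCLM.comp (fderiv ℝ (fun x => φ x p.1) x)) x := by
    refine Complex.ofRealCLM.hasFDerivAt.comp x (DifferentiableAt.hasFDerivAt ?_)
    exact ((EuclideanSpace.proj (𝕜 := ℝ) p.1).hasFDerivAt.comp x
      (hd x).hasFDerivAt).differentiableAt
  change fderiv ℝ (fun x => ((φ x p.1 : ℝ) : ℂ)) x _ = _
  rw [h.fderiv, grad_apply, ← fderiv_component hd]
  rfl

lemma fourier_lineDeriv_schwartzComponent {φ : E d → E n} (hφ : ContDiff ℝ ∞ φ)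
    (hc : HasCompactSupport φ) (p : Fin n × Fin d) (ξ : E d) :
    (𝓕 (∂_{(EuclideanSpace.single p.2 1 : E d)} (schwartzComponent hφ hc p.1))) ξ
      = (2 * Real.pi * Complex.I) * ((ξ p.2 : ℝ) * (𝓕 (schwartzComponent hφ hc p.1)) ξ) := by
  rw [SchwartzMap.fourier_lineDerivOp_eq, smul_apply,
    SchwartzMap.smulLeftCLM_apply_apply (by fun_prop)]
  simp [EuclideanSpace.inner_single_right]

/-- Plancherel: each derivative becomes multiplication by `2πi` times a frequency component, and the
two factors `i` cancel under conjugation. -/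
lemma integral_grad_mul_grad {φ : E d → E n} (hφ : ContDiff ℝ ∞ φ) (hc : HasCompactSupport φ)
    (p q : Fin n × Fin d) :
    Integrable (fun ξ : E d => (2 * Real.pi) ^ 2 * (ξ p.2 * ξ q.2 *
      (((𝓕 (schwartzComponent hφ hc p.1)) ξ).re * ((𝓕 (schwartzComponent hφ hc q.1)) ξ).re
        + ((𝓕 (schwartzComponent hφ hc p.1)) ξ).im * ((𝓕 (schwartzComponent hφ hc q.1)) ξ).im))) ∧
    ∫ x, grad φ x p * grad φ x q = ∫ ξ : E d, (2 * Real.pi) ^ 2 * (ξ p.2 * ξ q.2 *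
      (((𝓕 (schwartzComponent hφ hc p.1)) ξ).re * ((𝓕 (schwartzComponent hφ hc q.1)) ξ).re
        + ((𝓕 (schwartzComponent hφ hc p.1)) ξ).im * ((𝓕 (schwartzComponent hφ hc q.1)) ξ).im)) := by
  set P := ∂_{(EuclideanSpace.single p.2 1 : E d)} (schwartzComponent hφ hc p.1) with hP
  set Q := ∂_{(EuclideanSpace.single q.2 1 : E d)} (schwartzComponent hφ hc q.1) with hQ
  have hpl := SchwartzMap.integral_inner_fourier_fourier P Q
  have hint : Integrable (fun ξ => inner ℂ ((𝓕 P) ξ) ((𝓕 Q) ξ)) := by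
    refine (L2.integrable_inner (𝕜 := ℂ) ((𝓕 P).toLp 2) ((𝓕 Q).toLp 2)).congr ?_
    filter_upwards [SchwartzMap.coeFn_toLp (𝓕 P) 2 volume,
      SchwartzMap.coeFn_toLp (𝓕 Q) 2 volume] with x h1 h2
    rw [h1, h2]
  have hre : ∀ ξ : E d, (inner ℂ ((𝓕 P) ξ) ((𝓕 Q) ξ)).re = (2 * Real.pi) ^ 2 * (ξ p.2 * ξ q.2 *
      (((𝓕 (schwartzComponent hφ hc p.1)) ξ).re * ((𝓕 (schwartzComponent hφ hc q.1)) ξ).re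
        + ((𝓕 (schwartzComponent hφ hc p.1)) ξ).im
          * ((𝓕 (schwartzComponent hφ hc q.1)) ξ).im)) := by
    intro ξ
    rw [hP, hQ, fourier_lineDeriv_schwartzComponent, fourier_lineDeriv_schwartzComponent]
    simp only [RCLike.inner_apply, map_mul, Complex.conj_ofReal, Complex.conj_I, map_ofNat,
      Complex.mul_re, Complex.mul_im, Complex.ofReal_re, Complex.ofReal_im, Complex.I_re,
      Complex.I_im, Complex.neg_re, Complex.neg_im, Complex.re_ofNat, Complex.im_ofNat,
      Complex.conj_re, Complex.conj_im]
    ring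
  refine ⟨hint.re.congr (Eventually.of_forall hre), ?_⟩
  have h := congrArg Complex.re hpl
  have e1 : (∫ ξ, inner ℂ ((𝓕 P) ξ) ((𝓕 Q) ξ)).re = ∫ ξ, (inner ℂ ((𝓕 P) ξ) ((𝓕 Q) ξ)).re :=
    (integral_re hint).symm
  have e2 : ∫ x, inner ℂ (P x) (Q x) = ((∫ x, grad φ x p * grad φ x q : ℝ) : ℂ) := by
    rw [← integral_complex_ofReal]
    congr 1
    ext x
    rw [hP, hQ, lineDeriv_schwartzComponent, lineDeriv_schwartzComponent]
    simp [mul_comm]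
  rw [e1, e2, Complex.ofReal_re] at h
  rw [← h]
  exact integral_congr_ae (Eventually.of_forall hre)

lemma inner_act_eq_sum (B : Tens4 n d) (ζ : Tens n d) :
    inner ℝ (act B ζ) ζ = ∑ p, ∑ q, B p q * (ζ p * ζ q) := by
  simp only [PiLp.inner_apply, act_apply, RCLike.inner_apply, conj_trivial, Finset.mul_sum]
  refine Finset.sum_congr rfl fun p _ => Finset.sum_congr rfl fun q _ => ?_
  ring

lemma continuous_grad {φ : E d → E n} (hφ : ContDiff ℝ ∞ φ) : Continuous (grad φ) := by
  have h : Continuous (fderiv ℝ φ) := hφ.continuous_fderiv (by simp)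
  refine (PiLp.continuous_toLp 2 _).comp (continuous_pi fun p => ?_)
  exact (EuclideanSpace.proj (𝕜 := ℝ) p.1).continuous.comp (h.clm_apply continuous_const)

lemma grad_eq_zero_of_notMem {φ : E d → E n} {x : E d} (hx : x ∉ tsupport φ) : grad φ x = 0 := by
  ext p
  rw [grad_apply, fderiv_of_notMem_tsupport (𝕜 := ℝ) hx]
  rfl

lemma hasCompactSupport_grad {φ : E d → E n} (hc : HasCompactSupport φ) :
    HasCompactSupport (grad φ) :=
  HasCompactSupport.intro hc fun _ hx => grad_eq_zero_of_notMem hx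

/-- Gårding's inequality without lower order terms, for a constant tensor satisfying the
Legendre–Hadamard condition. -/
lemma integral_inner_act_grad_nonneg {B : Tens4 n d}
    (hB : ∀ (ξ : E n) (η : E d), 0 ≤ inner ℝ
      (act B (WithLp.toLp 2 (fun p => ξ p.1 * η p.2))) (WithLp.toLp 2 (fun p => ξ p.1 * η p.2)))
    {φ : E d → E n} (hφ : ContDiff ℝ ∞ φ) (hc : HasCompactSupport φ) :
    0 ≤ ∫ x, inner ℝ (act B (grad φ x)) (grad φ x) := by
  have hmem : MemLp (grad φ) 2 volume :=
    (continuous_grad hφ).memLp_of_hasCompactSupport (hasCompactSupport_grad hc)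
  have hcomp := memLp_piLp_iff.1 hmem
  have hint : ∀ p q, Integrable (fun x => B p q * (grad φ x p * grad φ x q)) := fun p q =>
    ((hcomp p).integrable_mul (hcomp q)).const_mul _
  simp_rw [inner_act_eq_sum]
  rw [integral_finsetSum _ fun p _ => integrable_finsetSum _ fun q _ => hint p q]
  have h1 : ∀ p, ∫ x, ∑ q, B p q * (grad φ x p * grad φ x q)
      = ∫ ξ : E d, ∑ q, B p q * ((2 * Real.pi) ^ 2 * (ξ p.2 * ξ q.2 *
      (((𝓕 (schwartzComponent hφ hc p.1)) ξ).re * ((𝓕 (schwartzComponent hφ hc q.1)) ξ).re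
        + ((𝓕 (schwartzComponent hφ hc p.1)) ξ).im
          * ((𝓕 (schwartzComponent hφ hc q.1)) ξ).im))) := by
    intro p
    rw [integral_finsetSum _ fun q _ => hint p q,
      integral_finsetSum _ fun q _ => (integral_grad_mul_grad hφ hc p q).1.const_mul _]
    refine Finset.sum_congr rfl fun q _ => ?_
    rw [integral_const_mul, integral_const_mul, (integral_grad_mul_grad hφ hc p q).2]
  simp_rw [h1]
  have hint' : ∀ p q, Integrable (fun ξ : E d => B p q * ((2 * Real.pi) ^ 2 * (ξ p.2 * ξ q.2 *
      (((𝓕 (schwartzComponent hφ hc p.1)) ξ).re * ((𝓕 (schwartzComponent hφ hc q.1)) ξ).re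
        + ((𝓕 (schwartzComponent hφ hc p.1)) ξ).im
          * ((𝓕 (schwartzComponent hφ hc q.1)) ξ).im)))) := fun p q =>
    (integral_grad_mul_grad hφ hc p q).1.const_mul _
  rw [← integral_finsetSum _ fun p _ => integrable_finsetSum _ fun q _ => hint' p q]
  refine integral_nonneg fun ξ => ?_
  -- The Legendre–Hadamard condition concerns real vectors, so it is applied separately to the real
  -- and imaginary parts of the transform, each tensored with the frequency.
  have hre := hB (WithLp.toLp 2 fun i => ((𝓕 (schwartzComponent hφ hc i)) ξ).re) ξ
  have him := hB (WithLp.toLp 2 fun i => ((𝓕 (schwartzComponent hφ hc i)) ξ).im) ξ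
  rw [inner_act_eq_sum] at hre him
  simp only [Pi.zero_apply]
  have key := mul_nonneg (sq_nonneg (2 * Real.pi)) (add_nonneg hre him)
  refine key.trans_eq ?_
  rw [← Finset.sum_add_distrib, Finset.mul_sum]
  refine Finset.sum_congr rfl fun p _ => ?_
  rw [← Finset.sum_add_distrib, Finset.mul_sum]
  refine Finset.sum_congr rfl fun q _ => ?_
  ring

/-- The quadratic form is continuous in the H¹ norm, so it suffices to treat smooth functions
supported in `Ω`, for which the integral extends to the whole space. -/
lemma setIntegral_inner_act_snd_nonneg {B : Tens4 n d}
    (hB : ∀ (ξ : E n) (η : E d), 0 ≤ inner ℝ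
      (act B (WithLp.toLp 2 (fun p => ξ p.1 * η p.2))) (WithLp.toLp 2 (fun p => ξ p.1 * η p.2)))
    {Ω : Set (E d)} {u : GraphSpace n Ω} (hu : u ∈ H10 n Ω) :
    0 ≤ ∫ x in Ω, inner ℝ (act B (u.snd x)) (u.snd x) := by
  let M : Lp (Tens n d) 2 (volume.restrict Ω) →L[ℝ] Lp (Tens n d) 2 (volume.restrict Ω) :=
    ContinuousLinearMap.compLpL 2 _ (Matrix.toEuclideanCLM (𝕜 := ℝ) B)
  have hM : ∀ g : Lp (Tens n d) 2 (volume.restrict Ω),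
      inner ℝ (M g) g = ∫ x in Ω, inner ℝ (act B (g x)) (g x) := by
    intro g
    rw [L2.inner_def]
    refine integral_congr_ae ?_
    filter_upwards [ContinuousLinearMap.coeFn_compLpL (p := 2) (μ := volume.restrict Ω)
      (Matrix.toEuclideanCLM (𝕜 := ℝ) B) g] with x hx
    rw [hx]
    rfl
  have hclosed : IsClosed {w : GraphSpace n Ω | 0 ≤ inner ℝ (M w.snd) w.snd} := by
    have hs : Continuous fun w : GraphSpace n Ω => w.snd := WithLp.continuous_snd ..
    exact isClosed_le continuous_const ((M.continuous.comp hs).inner hs)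
  have h := closure_minimal (t := {w : GraphSpace n Ω | 0 ≤ inner ℝ (M w.snd) w.snd}) ?_ hclosed hu
  · simpa [hM] using h
  · rintro w ⟨φ, hφ, hc, hsupp, -, hw⟩
    simp only [Set.mem_ofPred_eq, hM]
    have e : ∫ x in Ω, inner ℝ (act B (w.snd x)) (w.snd x)
        = ∫ x, inner ℝ (act B (grad φ x)) (grad φ x) := by
      rw [← setIntegral_eq_integral_of_forall_compl_eq_zero (s := Ω)
        (f := fun x => inner ℝ (act B (grad φ x)) (grad φ x))]
      · refine integral_congr_ae ?_
        filter_upwards [hw] with x hx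
        rw [hx]
      · intro x hx
        rw [grad_eq_zero_of_notMem fun h => hx (hsupp h), inner_zero_right]
    rw [e]
    exact integral_inner_act_grad_nonneg hB hφ hc

end Garding

/-! ### The energy estimate. -/

section Energy

variable {d n : ℕ} {Ω : Set (E d)}

lemma norm_sq_eq_integral {α F : Type*} [MeasurableSpace α] {μ : Measure α}
    [NormedAddCommGroup F] [InnerProductSpace ℝ F] (g : Lp F 2 μ) :
    ‖g‖ ^ 2 = ∫ x, ‖g x‖ ^ 2 ∂μ := by
  rw [← real_inner_self_eq_norm_sq, L2.inner_def]
  simp_rw [real_inner_self_eq_norm_sq]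

lemma LinftyPer.memLp_smul {g : E d → ℝ} (hg : LinftyPer g) {ε : ℝ} (hε : 0 < ε)
    {F : Type*} [NormedAddCommGroup F] [NormedSpace ℝ F] {v : E d → F}
    (hv : MemLp v 2 (volume.restrict Ω)) :
    MemLp (fun x => g (ε⁻¹ • x) • v x) 2 (volume.restrict Ω) :=
  hv.smul ((memLp_comp_smul hg.2 (inv_pos.2 hε)).restrict Ω)

lemma act_aEps (a₁ a₀ : E d → Tens4 n d) (ε : ℝ) (x : E d) (ζ : Tens n d) :
    act (aEps a₁ a₀ ε x) ζ = act (a₁ (ε⁻¹ • x)) ζ + ε ^ 2 • act (a₀ (ε⁻¹ • x)) ζ := by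
  rw [aEps, act_add_left, act_smul_left]

lemma memLp_act_aEps {a₁ a₀ : E d → Tens4 n d} (ha₁ : LinftyPerTens a₁) (ha₀ : LinftyPerTens a₀)
    {ε : ℝ} (hε : 0 < ε) {g : E d → Tens n d} (hg : MemLp g 2 (volume.restrict Ω)) :
    MemLp (fun x => act (aEps a₁ a₀ ε x) (g x)) 2 (volume.restrict Ω) := by
  have h0 : MemLp (fun x => ε ^ 2 • act (a₀ (ε⁻¹ • x)) (g x)) 2 (volume.restrict Ω) :=
    (ha₀.memLp_act_smul hε hg).const_smul (ε ^ 2)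
  simp_rw [act_aEps]
  exact (ha₁.memLp_act_smul hε hg).add h0

lemma ae_smul_of_ae {p : E d → Prop} (hp : ∀ᵐ y, p y) {ε : ℝ} (hε : 0 < ε) :
    ∀ᵐ x ∂(volume.restrict Ω), p (ε⁻¹ • x) :=
  ae_restrict_of_ae ((quasiMeasurePreserving_smul (inv_pos.2 hε)).ae hp)

lemma norm_sq_tensorProduct (ξ : E n) (η : E d) :
    ‖(WithLp.toLp 2 (fun p => ξ p.1 * η p.2) : Tens n d)‖ ^ 2 = ‖ξ‖ ^ 2 * ‖η‖ ^ 2 := by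
  simp only [EuclideanSpace.norm_sq_eq, Fintype.sum_prod_type, norm_mul, mul_pow,
    Finset.sum_mul_sum]

lemma inner_act_sub_smul_one (A : Tens4 n d) (ν : ℝ) (ζ : Tens n d) :
    inner ℝ (act (A + (-ν) • 1) ζ) ζ = inner ℝ (act A ζ) ζ - ν * ‖ζ‖ ^ 2 := by
  have h1 : act (1 : Tens4 n d) ζ = ζ := by
    ext p
    simp [act]
  rw [act_add_left, act_smul_left, h1, inner_add_left, real_inner_smul_left,
    real_inner_self_eq_norm_sq]
  ring

/-- Uses `a₁ + ε²a₀ = (1-ε²)a₁ + ε²(a₀+a₁)` with `1-ε² ≥ 1/2`. Splitting `A₀` into `A₀ - ν` and `ν`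
isolates the part that is non-negative only after integration. -/
lemma energy_density_le {a₁ a₀ A₀ : Tens4 n d} (ha₁ : a₁.PosSemidef) {ε ν : ℝ}
    (hε : ε ^ 2 ≤ 1 / 2) {ζ : Tens n d}
    (hcoer : inner ℝ (act A₀ ζ) ζ ≤ inner ℝ (act (a₀ + a₁) ζ) ζ) :
    1 / 2 * ‖act (tsqrt a₁) ζ‖ ^ 2
        + ε ^ 2 * (inner ℝ (act (A₀ + (-ν) • 1) ζ) ζ + ν * ‖ζ‖ ^ 2)
      ≤ inner ℝ (act a₁ ζ + ε ^ 2 • act a₀ ζ) ζ := by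
  have h1 := norm_sq_act_tsqrt ha₁ ζ
  have h0 : 0 ≤ inner ℝ (act a₁ ζ) ζ := by
    rw [← h1]
    positivity
  rw [inner_act_sub_smul_one, h1, inner_add_left, real_inner_smul_left]
  rw [act_add_left, inner_add_left] at hcoer
  have h2 := mul_le_mul_of_nonneg_left hcoer (sq_nonneg ε)
  nlinarith [mul_nonneg (sub_nonneg.2 hε) h0]

lemma energy_estimate {lam ν : ℝ} (hlam : 0 < lam)
    {ρ : E d → ℝ} (hρ : LinftyPer ρ) (hρν : ∀ᵐ y, ν ≤ ρ y) {a₁ a₀ : E d → Tens4 n d}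
    (ha₁ : LinftyPerTens a₁) (ha₀ : LinftyPerTens a₀) (hpos : ∀ᵐ y, (a₁ y).PosSemidef)
    {A₀ : Tens4 n d}
    (hcoer : ∀ᵐ y, ∀ ζ : Tens n d, inner ℝ (act A₀ ζ) ζ ≤ inner ℝ (act (a₀ y + a₁ y) ζ) ζ)
    (hA₀ : ∀ (ξ : E n) (η : E d), ν * ‖ξ‖ ^ 2 * ‖η‖ ^ 2 ≤
      inner ℝ (act A₀ (WithLp.toLp 2 (fun p => ξ p.1 * η p.2)))
        (WithLp.toLp 2 (fun p => ξ p.1 * η p.2)))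
    {ε : ℝ} (hε : 0 < ε) (hε2 : ε ^ 2 ≤ 1 / 2) {f : Lp (E n) 2 (volume.restrict Ω)}
    {u : GraphSpace n Ω} (hu : IsWeakSolution Ω a₁ a₀ ρ lam ε f u) :
    1 / 2 * (∫ x in Ω, ‖act (tsqrt (a₁ (ε⁻¹ • x))) (u.snd x)‖ ^ 2)
      + ε ^ 2 * (ν * ‖u.snd‖ ^ 2) + lam * ν * ‖u.fst‖ ^ 2 ≤ ‖f‖ * ‖u.fst‖ := by
  have hfst := Lp.memLp u.fst
  have hsnd := Lp.memLp u.snd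
  -- On `ξ ⊗ η` the identity has value `|ξ|²|η|²`, so `B` still satisfies the Legendre–Hadamard
  -- condition with constant 0.
  obtain ⟨B, hBdef⟩ : ∃ B : Tens4 n d, B = A₀ + (-ν) • 1 := ⟨_, rfl⟩
  have hgarding : 0 ≤ ∫ x in Ω, inner ℝ (act B (u.snd x)) (u.snd x) := by
    refine setIntegral_inner_act_snd_nonneg (fun ξ η => ?_) hu.1
    rw [hBdef, inner_act_sub_smul_one, norm_sq_tensorProduct, ← mul_assoc]
    exact sub_nonneg.2 (hA₀ ξ η)
  have hX := ((ha₁.tsqrt hpos).memLp_act_smul hε hsnd).norm.integrable_sq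
  have hB : Integrable (fun x => inner ℝ (act B (u.snd x)) (u.snd x)) (volume.restrict Ω) :=
    integrable_inner_of_memLp
      (memLp_act_of_entries (b := fun _ => B) (fun p q => memLp_top_const (B p q)) hsnd) hsnd
  have hG : Integrable (fun x => ‖u.snd x‖ ^ 2) (volume.restrict Ω) := hsnd.norm.integrable_sq
  have hU : Integrable (fun x => ‖u.fst x‖ ^ 2) (volume.restrict Ω) := hfst.norm.integrable_sq
  have hA : Integrable (fun x => inner ℝ (act (aEps a₁ a₀ ε x) (u.snd x)) (u.snd x))
      (volume.restrict Ω) :=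
    integrable_inner_of_memLp (memLp_act_aEps ha₁ ha₀ hε hsnd) hsnd
  have hR : Integrable (fun x => lam * ρ (ε⁻¹ • x) * inner ℝ (u.fst x) (u.fst x))
      (volume.restrict Ω) := by
    have := (integrable_inner_of_memLp (hρ.memLp_smul hε hfst) hfst).const_mul lam
    simpa only [real_inner_smul_left, mul_assoc] using this
  have hBG : Integrable (fun x => inner ℝ (act B (u.snd x)) (u.snd x) + ν * ‖u.snd x‖ ^ 2)
      (volume.restrict Ω) := hB.add (hG.const_mul ν)
  have hXB : Integrable (fun x => 1 / 2 * ‖act (tsqrt (a₁ (ε⁻¹ • x))) (u.snd x)‖ ^ 2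
      + ε ^ 2 * (inner ℝ (act B (u.snd x)) (u.snd x) + ν * ‖u.snd x‖ ^ 2)) (volume.restrict Ω) :=
    (hX.const_mul (1 / 2)).add (hBG.const_mul (ε ^ 2))
  have hleft : Integrable (fun x => (1 / 2 * ‖act (tsqrt (a₁ (ε⁻¹ • x))) (u.snd x)‖ ^ 2
      + ε ^ 2 * (inner ℝ (act B (u.snd x)) (u.snd x) + ν * ‖u.snd x‖ ^ 2))
        + lam * ν * ‖u.fst x‖ ^ 2) (volume.restrict Ω) :=
    hXB.add (hU.const_mul (lam * ν))
  have hright : Integrable (fun x => inner ℝ (act (aEps a₁ a₀ ε x) (u.snd x)) (u.snd x)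
      + lam * ρ (ε⁻¹ • x) * inner ℝ (u.fst x) (u.fst x)) (volume.restrict Ω) := hA.add hR
  have hlhs : 1 / 2 * (∫ x in Ω, ‖act (tsqrt (a₁ (ε⁻¹ • x))) (u.snd x)‖ ^ 2)
      + ε ^ 2 * (∫ x in Ω, inner ℝ (act B (u.snd x)) (u.snd x) + ν * ‖u.snd x‖ ^ 2)
      + lam * ν * ‖u.fst‖ ^ 2
      = ∫ x in Ω, ((1 / 2 * ‖act (tsqrt (a₁ (ε⁻¹ • x))) (u.snd x)‖ ^ 2
        + ε ^ 2 * (inner ℝ (act B (u.snd x)) (u.snd x) + ν * ‖u.snd x‖ ^ 2))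
        + lam * ν * ‖u.fst x‖ ^ 2) := by
    rw [integral_add hXB (hU.const_mul _), integral_add (hX.const_mul _) (hBG.const_mul _),
      integral_const_mul, integral_const_mul, integral_const_mul, norm_sq_eq_integral u.fst]
  have hle := hu.2 u hu.1
  have hcs : ∫ x in Ω, inner ℝ (f x) (u.fst x) ≤ ‖f‖ * ‖u.fst‖ := by
    rw [← L2.inner_def (𝕜 := ℝ) f u.fst]
    exact real_inner_le_norm _ _
  have hmono : ∫ x in Ω, ((1 / 2 * ‖act (tsqrt (a₁ (ε⁻¹ • x))) (u.snd x)‖ ^ 2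
        + ε ^ 2 * (inner ℝ (act B (u.snd x)) (u.snd x) + ν * ‖u.snd x‖ ^ 2))
        + lam * ν * ‖u.fst x‖ ^ 2)
      ≤ ∫ x in Ω, (inner ℝ (act (aEps a₁ a₀ ε x) (u.snd x)) (u.snd x)
        + lam * ρ (ε⁻¹ • x) * inner ℝ (u.fst x) (u.fst x)) := by
    refine integral_mono_ae hleft hright ?_
    filter_upwards [ae_smul_of_ae (Ω := Ω) hcoer hε, ae_smul_of_ae (Ω := Ω) hpos hε,
      ae_smul_of_ae (Ω := Ω) hρν hε] with x h1 h2 h3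
    refine add_le_add ?_ ?_
    · rw [act_aEps]
      rw [hBdef]
      exact energy_density_le h2 hε2 (h1 _)
    · rw [real_inner_self_eq_norm_sq]
      gcongr
  have hsplit : ∫ x in Ω, inner ℝ (act B (u.snd x)) (u.snd x) + ν * ‖u.snd x‖ ^ 2
      = (∫ x in Ω, inner ℝ (act B (u.snd x)) (u.snd x)) + ν * ‖u.snd‖ ^ 2 := by
    rw [integral_add hB (hG.const_mul _), integral_const_mul, norm_sq_eq_integral u.snd]
  have hmul := mul_nonneg (sq_nonneg ε) hgarding
  rw [← hlhs, hsplit, mul_add] at hmono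
  linarith

/-- The zeroth order term gives `λνv² ≤ Cv`, which bounds `v`; the right side is then at most
`C·C/(λν)`, and this controls the other two terms. -/
lemma norm_bounds_of_energy {lam ν X g v F C ε : ℝ} (hlam : 0 < lam) (hν : 0 < ν)
    (hv : 0 ≤ v) (hC : 0 ≤ C) (hF : F ≤ C)
    (h : 1 / 2 * X + ε ^ 2 * (ν * g ^ 2) + lam * ν * v ^ 2 ≤ F * v) (hX : 0 ≤ X) :
    v ≤ C / (lam * ν) ∧ ε * g ≤ √(C * (C / (lam * ν)) / ν) ∧ X ≤ 2 * (C * (C / (lam * ν))) := by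
  have hl : 0 < lam * ν := mul_pos hlam hν
  have hFv : F * v ≤ C * v := mul_le_mul_of_nonneg_right hF hv
  have p2 : 0 ≤ ε ^ 2 * (ν * g ^ 2) := by positivity
  have p3 : 0 ≤ lam * ν * v ^ 2 := by positivity
  have hv' : v ≤ C / (lam * ν) := by
    rw [le_div_iff₀ hl]
    rcases hv.eq_or_lt with h0 | h0
    · simpa [← h0] using hC
    · refine le_of_mul_le_mul_right ?_ h0
      nlinarith
  have hCv : C * v ≤ C * (C / (lam * ν)) := mul_le_mul_of_nonneg_left hv' hC
  refine ⟨hv', Real.le_sqrt_of_sq_le ?_, by linarith⟩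
  rw [le_div_iff₀ hν]
  nlinarith

end Energy

/-! ### Oscillating test functions `θ(x) φ(x/ε)`. -/

section SeparatedTestFunctions

variable {d n : ℕ} {F : Type*} [NormedAddCommGroup F] [NormedSpace ℝ F] {Ω : Set (E d)}

lemma contDiff_fderiv_apply {φ : E d → F} (hφ : ContDiff ℝ ∞ φ) (v : E d) :
    ContDiff ℝ ∞ (fun x => fderiv ℝ φ x v) :=
  (hφ.fderiv_right (m := ∞) (by simp)).clm_apply contDiff_const

lemma QPeriodic.fderiv {φ : E d → F} (hφ : QPeriodic φ) : QPeriodic (fderiv ℝ φ) := by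
  intro k y
  rw [← fderiv_comp_add_right]
  congr 1
  ext z
  rw [hφ k z]

lemma QPeriodic.grad {φ : E d → E n} (hφ : QPeriodic φ) : QPeriodic (grad φ) := by
  intro k y
  simp only [TwoScale.grad, hφ.fderiv k y]

lemma contDiff_grad {φ : E d → E n} (hφ : ContDiff ℝ ∞ φ) : ContDiff ℝ ∞ (grad φ) := by
  refine contDiff_euclidean.2 fun p => ?_
  exact (EuclideanSpace.proj (𝕜 := ℝ) p.1).contDiff.comp (contDiff_fderiv_apply hφ _)

lemma tsupport_fderiv_apply_subset {θ : E d → ℝ} (v : E d) {x : E d} (hx : x ∉ tsupport θ) :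
    fderiv ℝ θ x v = 0 := by
  rw [fderiv_of_notMem_tsupport (𝕜 := ℝ) hx]
  rfl

lemma isTestFun_smul {θ : E d → ℝ} (hθ : ContDiff ℝ ∞ θ) {K : Set (E d)} (hK : IsCompact K)
    (hKΩ : K ⊆ Ω) (hθK : ∀ x ∉ K, θ x = 0) {φ : E d → F} (hφ : ContDiff ℝ ∞ φ)
    (hper : QPeriodic φ) : IsTestFun Ω (fun x y => θ x • φ y) := by
  refine ⟨(hθ.comp contDiff_fst).smul (hφ.comp contDiff_snd), fun x k y => ?_, K, hK, hKΩ,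
    fun x hx y => ?_⟩
  · simp only [hper k y]
  · simp only [hθK x hx, zero_smul]

/-- The tensor `φ ⊗ ∇θ`. -/
def tensorGrad (θ : E d → ℝ) (φ : E d → E n) (x y : E d) : Tens n d :=
  WithLp.toLp 2 (fun p => fderiv ℝ θ x (EuclideanSpace.single p.2 1) * φ y p.1)

lemma isTestFun_tensorGrad {θ : E d → ℝ} (hθ : ContDiff ℝ ∞ θ) (hc : HasCompactSupport θ)
    (hs : tsupport θ ⊆ Ω) {φ : E d → E n} (hφ : ContDiff ℝ ∞ φ) (hper : QPeriodic φ) :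
    IsTestFun Ω (tensorGrad θ φ) := by
  refine ⟨contDiff_euclidean.2 fun p => ?_, fun x k y => ?_, tsupport θ, hc, hs, fun x hx y => ?_⟩
  · exact ((contDiff_fderiv_apply hθ _).comp contDiff_fst).mul
      (((EuclideanSpace.proj (𝕜 := ℝ) p.1).contDiff.comp hφ).comp contDiff_snd)
  · simp only [tensorGrad, hper k y]
  · ext p
    simp [tensorGrad, tsupport_fderiv_apply_subset _ hx]

lemma fderiv_smul_comp_smul {θ : E d → ℝ} (hθ : ContDiff ℝ ∞ θ) {φ : E d → F}
    (hφ : ContDiff ℝ ∞ φ) (c : ℝ) (x v : E d) :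
    fderiv ℝ (fun x => θ x • φ (c • x)) x v
      = fderiv ℝ θ x v • φ (c • x) + (θ x * c) • fderiv ℝ φ (c • x) v := by
  have h1 : DifferentiableAt ℝ θ x := differentiable_of_smooth hθ x
  have h2 : DifferentiableAt ℝ (fun x => φ (c • x)) x :=
    differentiable_of_smooth (hφ.comp (contDiff_id.const_smul c)) x
  rw [fderiv_fun_smul h1 h2, fderiv_comp_smul]
  simp [smul_smul, add_comm]

lemma smooth_smul_comp_smul {θ : E d → ℝ} (hθ : ContDiff ℝ ∞ θ) {φ : E d → F}
    (hφ : ContDiff ℝ ∞ φ) (c : ℝ) : ContDiff ℝ ∞ (fun x => θ x • φ (c • x)) :=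
  hθ.smul (hφ.comp (contDiff_id.const_smul c))

lemma grad_smul_comp_smul {θ : E d → ℝ} (hθ : ContDiff ℝ ∞ θ) {φ : E d → E n}
    (hφ : ContDiff ℝ ∞ φ) (c : ℝ) (x : E d) :
    grad (fun x => θ x • φ (c • x)) x = tensorGrad θ φ x (c • x) + (θ x * c) • grad φ (c • x) := by
  ext p
  simp [grad_apply, fderiv_smul_comp_smul hθ hφ, tensorGrad]

end SeparatedTestFunctions

/-! ### Integration by parts in `H10`. -/

section ZeroTrace

variable {d n : ℕ} {Ω : Set (E d)}

lemma exists_mem_H10 {φ : E d → E n} (hφ : ContDiff ℝ ∞ φ) (hc : HasCompactSupport φ)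
    (hs : tsupport φ ⊆ Ω) : ∃ w ∈ H10 n Ω, w.fst =ᵐ[volume.restrict Ω] φ ∧
      w.snd =ᵐ[volume.restrict Ω] grad φ := by
  have h1 : MemLp φ 2 (volume.restrict Ω) := hφ.continuous.memLp_of_hasCompactSupport hc
  have h2 : MemLp (grad φ) 2 (volume.restrict Ω) :=
    (continuous_grad hφ).memLp_of_hasCompactSupport (hasCompactSupport_grad hc)
  exact ⟨WithLp.toLp 2 (h1.toLp, h2.toLp), subset_closure
    ⟨φ, hφ, hc, hs, h1.coeFn_toLp, h2.coeFn_toLp⟩, h1.coeFn_toLp, h2.coeFn_toLp⟩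

lemma integral_mul_fderiv_component {φ : E d → E n} (hφ : ContDiff ℝ ∞ φ)
    (hc : HasCompactSupport φ) {g : E d → ℝ} (hg : ContDiff ℝ ∞ g) (i : Fin n) (j : Fin d) :
    ∫ x, φ x i * fderiv ℝ g x (EuclideanSpace.single j 1) = -∫ x, grad φ x (i, j) * g x := by
  have hφi : ContDiff ℝ ∞ (fun x => φ x i) := (EuclideanSpace.proj (𝕜 := ℝ) i).contDiff.comp hφ
  have hci : HasCompactSupport (fun x => φ x i) := hc.comp_left (g := fun v : E n => v i) (by simp)
  have hgr : ∀ x, grad φ x (i, j) = fderiv ℝ (fun x => φ x i) x (EuclideanSpace.single j 1) :=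
    fun x => (fderiv_component (differentiable_of_smooth hφ) i x _).symm
  simp_rw [hgr]
  have hcd : HasCompactSupport (fun x => fderiv ℝ (fun x => φ x i) x (EuclideanSpace.single j 1)) :=
    HasCompactSupport.intro hci fun x hx => tsupport_fderiv_apply_subset _ hx
  refine integral_mul_fderiv_eq_neg_fderiv_mul_of_integrable ?_ ?_ ?_
    (fun x _ => differentiable_of_smooth hφi x) (fun x _ => differentiable_of_smooth hg x)
  · exact ((contDiff_fderiv_apply hφi _).continuous.mul hg.continuous
      ).integrable_of_hasCompactSupport hcd.mul_right
  · exact (hφi.continuous.mul (contDiff_fderiv_apply hg _).continuous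
      ).integrable_of_hasCompactSupport hci.mul_right
  · exact (hφi.continuous.mul hg.continuous).integrable_of_hasCompactSupport hci.mul_right

/-- Integration by parts for functions with zero trace. -/
lemma integral_by_parts_of_mem_H10 {u : GraphSpace n Ω} (hu : u ∈ H10 n Ω) {g : E d → ℝ}
    (hg : ContDiff ℝ ∞ g) (hgc : HasCompactSupport g) (i : Fin n) (j : Fin d) :
    (∫ x in Ω, inner ℝ (u.fst x)
        (fderiv ℝ g x (EuclideanSpace.single j 1) • (EuclideanSpace.single i 1 : E n)))
      + ∫ x in Ω, inner ℝ (u.snd x) (g x • (EuclideanSpace.single (i, j) 1 : Tens n d)) = 0 := by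
  have hm1 : MemLp (fun x => fderiv ℝ g x (EuclideanSpace.single j 1) •
      (EuclideanSpace.single i 1 : E n)) 2 (volume.restrict Ω) := by
    refine ((contDiff_fderiv_apply hg _).continuous.smul
      continuous_const).memLp_of_hasCompactSupport (HasCompactSupport.intro hgc fun x hx => ?_)
    simp [tsupport_fderiv_apply_subset _ hx]
  have hm2 : MemLp (fun x => g x • (EuclideanSpace.single (i, j) 1 : Tens n d)) 2
      (volume.restrict Ω) :=
    (hg.continuous.smul continuous_const).memLp_of_hasCompactSupport hgc.smul_right
  have hI : ∀ w : GraphSpace n Ω, inner ℝ w.fst (hm1.toLp) + inner ℝ w.snd (hm2.toLp)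
      = (∫ x in Ω, inner ℝ (w.fst x)
        (fderiv ℝ g x (EuclideanSpace.single j 1) • (EuclideanSpace.single i 1 : E n)))
      + ∫ x in Ω, inner ℝ (w.snd x) (g x • (EuclideanSpace.single (i, j) 1 : Tens n d)) := by
    intro w
    rw [L2.inner_def, L2.inner_def]
    congr 1
    · refine integral_congr_ae ?_
      filter_upwards [hm1.coeFn_toLp] with x hx
      rw [hx]
    · refine integral_congr_ae ?_
      filter_upwards [hm2.coeFn_toLp] with x hx
      rw [hx]
  rw [← hI]
  -- The identity is linear and continuous in the pair, so it passes from smooth functions supported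
  -- in `Ω` to their closure; `g` need not vanish near the boundary.
  have hclosed : IsClosed {w : GraphSpace n Ω |
      inner ℝ w.fst (hm1.toLp) + inner ℝ w.snd (hm2.toLp) = 0} := by
    have h1 : Continuous fun w : GraphSpace n Ω => w.fst := WithLp.continuous_fst ..
    have h2 : Continuous fun w : GraphSpace n Ω => w.snd := WithLp.continuous_snd ..
    exact isClosed_eq ((h1.inner continuous_const).add (h2.inner continuous_const))
      continuous_const
  refine closure_minimal (t := {w : GraphSpace n Ω |
      inner ℝ w.fst (hm1.toLp) + inner ℝ w.snd (hm2.toLp) = 0}) ?_ hclosed hu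
  rintro w ⟨φ, hφ, hc, hsupp, hw1, hw2⟩
  simp only [Set.mem_ofPred_eq, hI]
  have e1 : ∫ x in Ω, inner ℝ (w.fst x)
        (fderiv ℝ g x (EuclideanSpace.single j 1) • (EuclideanSpace.single i 1 : E n))
      = ∫ x, φ x i * fderiv ℝ g x (EuclideanSpace.single j 1) := by
    rw [← setIntegral_eq_integral_of_forall_compl_eq_zero (s := Ω)
      (f := fun x => φ x i * fderiv ℝ g x (EuclideanSpace.single j 1))]
    · refine integral_congr_ae ?_
      filter_upwards [hw1] with x hx
      rw [hx]
      simp [real_inner_smul_right, EuclideanSpace.inner_single_right, mul_comm]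
    · intro x hx
      have : φ x = 0 := image_eq_zero_of_notMem_tsupport fun h => hx (hsupp h)
      simp [this]
  have e2 : ∫ x in Ω, inner ℝ (w.snd x) (g x • (EuclideanSpace.single (i, j) 1 : Tens n d))
      = ∫ x, grad φ x (i, j) * g x := by
    rw [← setIntegral_eq_integral_of_forall_compl_eq_zero (s := Ω)
      (f := fun x => grad φ x (i, j) * g x)]
    · refine integral_congr_ae ?_
      filter_upwards [hw2] with x hx
      rw [hx]
      simp [real_inner_smul_right, EuclideanSpace.inner_single_right, mul_comm]
    · intro x hx
      rw [grad_eq_zero_of_notMem fun h => hx (hsupp h)]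
      simp
  rw [e1, e2, integral_mul_fderiv_component hφ hc hg, neg_add_cancel]

end ZeroTrace

/-! ### The limit of `ε∇u` is the periodic gradient of the limit of `u`. -/

section Limits

variable {d n : ℕ} {F : Type*} [NormedAddCommGroup F] [InnerProductSpace ℝ F] {Ω : Set (E d)}
  {ε : ℕ → ℝ}

/-- The integrals are bounded by Cauchy–Schwarz, the norms of the unfolded test functions being
convergent. -/
lemma tendsto_mul_setIntegral_zero (hε : ∀ k, 0 < ε k) (hε0 : Tendsto ε atTop (𝓝 0))
    (hΩ : MeasurableSet Ω) {w : ℕ → E d → F} (hw : ∀ k, MemLp (w k) 2 (volume.restrict Ω)) {C : ℝ}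
    (hC : ∀ k, (eLpNorm (w k) 2 (volume.restrict Ω)).toReal ≤ C) {ψ : E d → E d → F}
    (hψ : IsTestFun Ω ψ) :
    Tendsto (fun k => ε k * ∫ x in Ω, inner ℝ (w k x) (ψ x ((ε k)⁻¹ • x))) atTop (𝓝 0) := by
  have hI : ∀ k, ∫ x in Ω, inner ℝ (w k x) (ψ x ((ε k)⁻¹ • x))
      = inner ℝ (unfoldLp (memLp_indicator_of_restrict hΩ (hw k)) (hε k))
        (unfoldLp (hψ.memLp_diag (ε k)) (hε k)) := by
    intro k
    rw [inner_unfoldLp, ← integral_indicator hΩ]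
    congr 1
    ext x
    by_cases hx : x ∈ Ω <;> simp [hx]
  refine squeeze_zero_norm
    (a := fun k => ε k * (C * ‖unfoldLp (hψ.memLp_diag (ε k)) (hε k)‖)) (fun k => ?_) ?_
  · rw [norm_mul, Real.norm_of_nonneg (hε k).le, hI]
    refine mul_le_mul_of_nonneg_left ((norm_inner_le_norm _ _).trans ?_) (hε k).le
    refine mul_le_mul_of_nonneg_right ?_ (norm_nonneg _)
    rw [norm_unfoldLp, eLpNorm_indicator_eq_eLpNorm_restrict hΩ]
    exact hC k
  · simpa using hε0.mul ((hψ.tendsto_unfoldLp hε hε0).norm.const_mul C)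

lemma ae_eq_zero_of_setIntegral_mul_eq_zero (hΩ : IsOpen Ω) {b : E d → ℝ}
    (hb : MemLp b 2 (volume.restrict Ω))
    (h : ∀ θ : E d → ℝ, ContDiff ℝ ∞ θ → HasCompactSupport θ → tsupport θ ⊆ Ω →
      ∫ x in Ω, θ x * b x = 0) : ∀ᵐ x ∂(volume.restrict Ω), b x = 0 := by
  rw [ae_restrict_iff' hΩ.measurableSet]
  refine hΩ.ae_eq_zero_of_integral_contDiff_smul_eq_zero
    (locallyIntegrableOn_of_locallyIntegrable_restrict (hb.locallyIntegrable one_le_two)) ?_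
  intro θ hθ hc hs
  rw [← h θ hθ hc hs, setIntegral_eq_integral_of_forall_compl_eq_zero]
  · rfl
  · intro x hx
    rw [image_eq_zero_of_notMem_tsupport fun h => hx (hs h), zero_mul]

lemma memLp_cell_of_continuous {X : Type*} [NormedAddCommGroup X] {φ : E d → X} (hφ : Continuous φ) :
    MemLp φ 2 (volume.restrict (cell d)) := by
  obtain ⟨C, hC⟩ := isCompact_cell.exists_bound_of_continuousOn (f := φ) hφ.continuousOn
  exact MemLp.of_bound hφ.aestronglyMeasurable C
    ((ae_restrict_iff' measurableSet_cell).2 (Eventually.of_forall hC))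

lemma setIntegral_cell_inner_smul (z : CellL2 d F) {φ : E d → F}
    (hφ : MemLp φ 2 (volume.restrict (cell d))) (c : ℝ) :
    ∫ y in cell d, inner ℝ (z y) (c • φ y) = c * inner ℝ z hφ.toLp := by
  rw [L2.inner_def, ← integral_const_mul]
  refine integral_congr_ae ?_
  filter_upwards [hφ.coeFn_toLp] with y hy
  rw [hy, real_inner_smul_right]

lemma memLp_fderiv_smul_single {φ : E d → ℝ} (hφ : ContDiff ℝ ∞ φ) (i : Fin n) (j : Fin d) :
    MemLp (fun y => fderiv ℝ φ y (EuclideanSpace.single j 1) • (EuclideanSpace.single i 1 : E n))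
      2 (volume.restrict (cell d)) :=
  memLp_cell_of_continuous ((contDiff_fderiv_apply hφ _).continuous.smul continuous_const)

lemma memLp_smul_single {φ : E d → ℝ} (hφ : ContDiff ℝ ∞ φ) (i : Fin n) (j : Fin d) :
    MemLp (fun y => φ y • (EuclideanSpace.single (i, j) 1 : Tens n d))
      2 (volume.restrict (cell d)) :=
  memLp_cell_of_continuous (hφ.continuous.smul continuous_const)

/-- Integration by parts against `θ(x)φ(x/ε)`, multiplied by `ε`: the derivative of `θ` keeps a
factor `ε` and disappears, that of `φ` survives. Since `θ` is arbitrary, the limit identity holds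
for almost every `x`. -/
lemma ae_inner_add_inner_eq_zero (hΩ : IsOpen Ω) (hε : ∀ k, 0 < ε k)
    (hε0 : Tendsto ε atTop (𝓝 0))
    {u : ℕ → GraphSpace n Ω} (hu : ∀ k, u k ∈ H10 n Ω) {z : E d → CellL2 d (E n)}
    {p : E d → CellL2 d (Tens n d)}
    (hz : TwoScaleConverges Ω ε (fun k x => (u k).fst x) z)
    (hp : TwoScaleConverges Ω ε (fun k x => ε k • (u k).snd x) p)
    {φ : E d → ℝ} (hφ : ContDiff ℝ ∞ φ) (hper : QPeriodic φ) (i : Fin n) (j : Fin d) :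
    ∀ᵐ x ∂(volume.restrict Ω), inner ℝ (z x) (memLp_fderiv_smul_single hφ i j).toLp
      + inner ℝ (p x) (memLp_smul_single hφ i j).toLp = 0 := by
  obtain ⟨h1, hh1⟩ : ∃ h, h = (memLp_fderiv_smul_single hφ i j).toLp := ⟨_, rfl⟩
  obtain ⟨h2, hh2⟩ : ∃ h, h = (memLp_smul_single hφ i j).toLp := ⟨_, rfl⟩
  have hzm : MemLp (fun x => inner ℝ (z x) h1) 2 (volume.restrict Ω) := hz.2.2.1.inner_const h1
  have hpm : MemLp (fun x => inner ℝ (p x) h2) 2 (volume.restrict Ω) := hp.2.2.1.inner_const h2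
  rw [← hh1, ← hh2]
  refine ae_eq_zero_of_setIntegral_mul_eq_zero hΩ (hzm.add hpm) ?_
  intro θ hθ hc hs
  have hθK : ∀ x ∉ tsupport θ, θ x = 0 := fun x hx => image_eq_zero_of_notMem_tsupport hx
  have ψ1 : IsTestFun Ω (fun x y => fderiv ℝ θ x (EuclideanSpace.single j 1) •
      (φ y • (EuclideanSpace.single i 1 : E n))) :=
    isTestFun_smul (contDiff_fderiv_apply hθ _) hc hs
      (fun x hx => tsupport_fderiv_apply_subset _ hx) (hφ.smul contDiff_const)
      (fun k y => by simp only [hper k y])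
  have ψ2 : IsTestFun Ω (fun x y => θ x • (fderiv ℝ φ y (EuclideanSpace.single j 1) •
      (EuclideanSpace.single i 1 : E n))) :=
    isTestFun_smul hθ hc hs hθK ((contDiff_fderiv_apply hφ _).smul contDiff_const)
      (fun k y => by simp only [hper.fderiv k y])
  have ψ3 : IsTestFun Ω (fun x y => θ x • (φ y • (EuclideanSpace.single (i, j) 1 : Tens n d))) :=
    isTestFun_smul hθ hc hs hθK (hφ.smul contDiff_const) (fun k y => by simp only [hper k y])
  have hlim := ((hε0.mul (hz.2.2.2 _ ψ1)).add (hz.2.2.2 _ ψ2)).add (hp.2.2.2 _ ψ3)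
  have hzero : ∀ k, ε k * (∫ x in Ω, inner ℝ ((u k).fst x)
        (fderiv ℝ θ x (EuclideanSpace.single j 1) •
          (φ ((ε k)⁻¹ • x) • (EuclideanSpace.single i 1 : E n))))
      + (∫ x in Ω, inner ℝ ((u k).fst x)
        (θ x • (fderiv ℝ φ ((ε k)⁻¹ • x) (EuclideanSpace.single j 1) •
          (EuclideanSpace.single i 1 : E n))))
      + (∫ x in Ω, inner ℝ (ε k • (u k).snd x)
        (θ x • (φ ((ε k)⁻¹ • x) • (EuclideanSpace.single (i, j) 1 : Tens n d)))) = 0 := by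
    intro k
    have hparts := integral_by_parts_of_mem_H10 (hu k)
      (smooth_smul_comp_smul hθ hφ (ε k)⁻¹) (hc.smul_right) i j
    have i1 := integrable_inner_of_memLp (hz.1 k) ((ψ1.memLp_diag (ε k)).restrict Ω)
    have i2 := integrable_inner_of_memLp (hz.1 k) ((ψ2.memLp_diag (ε k)).restrict Ω)
    have hne := (hε k).ne'
    have e1 : ∫ x in Ω, inner ℝ ((u k).fst x)
        (fderiv ℝ (fun x => θ x • φ ((ε k)⁻¹ • x)) x (EuclideanSpace.single j 1) •
          (EuclideanSpace.single i 1 : E n))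
        = (∫ x in Ω, inner ℝ ((u k).fst x)
        (fderiv ℝ θ x (EuclideanSpace.single j 1) •
          (φ ((ε k)⁻¹ • x) • (EuclideanSpace.single i 1 : E n))))
        + (ε k)⁻¹ * ∫ x in Ω, inner ℝ ((u k).fst x)
        (θ x • (fderiv ℝ φ ((ε k)⁻¹ • x) (EuclideanSpace.single j 1) •
          (EuclideanSpace.single i 1 : E n))) := by
      rw [← integral_const_mul, ← integral_add i1 (i2.const_mul _)]
      refine integral_congr_ae (Eventually.of_forall fun x => ?_)
      beta_reduce
      rw [fderiv_smul_comp_smul hθ hφ]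
      simp only [real_inner_smul_right, add_smul, inner_add_right, smul_eq_mul]
      ring
    have e2 : ∫ x in Ω, inner ℝ (ε k • (u k).snd x)
        (θ x • (φ ((ε k)⁻¹ • x) • (EuclideanSpace.single (i, j) 1 : Tens n d)))
        = ε k * ∫ x in Ω, inner ℝ ((u k).snd x)
        ((θ x • φ ((ε k)⁻¹ • x)) • (EuclideanSpace.single (i, j) 1 : Tens n d)) := by
      rw [← integral_const_mul]
      refine integral_congr_ae (Eventually.of_forall fun x => ?_)
      simp only [real_inner_smul_right, real_inner_smul_left, smul_eq_mul]
      ring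
    rw [e1] at hparts
    rw [e2]
    have h2 := congrArg (fun t => ε k * t) hparts
    simp only [mul_zero, mul_add, mul_inv_cancel_left₀ hne] at h2
    exact h2
  have hfin := tendsto_nhds_unique hlim ((tendsto_congr hzero).2 tendsto_const_nhds)
  rw [zero_mul, zero_add] at hfin
  rw [← hfin]
  simp only [setIntegral_cell_inner_smul _ (memLp_fderiv_smul_single hφ i j),
    setIntegral_cell_inner_smul _ (memLp_smul_single hφ i j)]
  have hθ2 : MemLp θ 2 (volume.restrict Ω) := hθ.continuous.memLp_of_hasCompactSupport hc
  have iz : Integrable (fun x => θ x * inner ℝ (z x) h1) (volume.restrict Ω) :=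
    hθ2.integrable_mul hzm
  have ip : Integrable (fun x => θ x * inner ℝ (p x) h2) (volume.restrict Ω) :=
    hθ2.integrable_mul hpm
  rw [← hh1, ← hh2, ← integral_add iz ip]
  simp only [mul_add]

lemma ae_mem_H1per (hΩ : IsOpen Ω) (hε : ∀ k, 0 < ε k) (hε0 : Tendsto ε atTop (𝓝 0))
    {u : ℕ → GraphSpace n Ω} (hu : ∀ k, u k ∈ H10 n Ω) {z : E d → CellL2 d (E n)}
    {p : E d → CellL2 d (Tens n d)}
    (hz : TwoScaleConverges Ω ε (fun k x => (u k).fst x) z)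
    (hp : TwoScaleConverges Ω ε (fun k x => ε k • (u k).snd x) p) :
    ∀ᵐ x ∂(volume.restrict Ω), (WithLp.toLp 2 (z x, p x) : GraphSpace n (cell d)) ∈ H1per d n := by
  -- Membership in `H1per` is orthogonality to these pairs; separability then makes the exceptional
  -- set of `x` independent of `φ`.
  let A : Set (GraphSpace n (cell d)) := {v | ∃ (φ : E d → ℝ) (hφ : ContDiff ℝ ∞ φ)
    (_ : QPeriodic φ) (i : Fin n) (j : Fin d), v = WithLp.toLp 2
      ((memLp_fderiv_smul_single hφ i j).toLp, (memLp_smul_single hφ i j).toLp)}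
  have hsep : TopologicalSpace.SeparableSpace (GraphSpace n (cell d)) :=
    (WithLp.toLp_surjective 2).denseRange.separableSpace
      (WithLp.prod_continuous_toLp 2 (CellL2 d (E n)) (CellL2 d (Tens n d)))
  have key : ∀ᵐ x ∂(volume.restrict Ω), ∀ v ∈ A,
      inner ℝ (WithLp.toLp 2 (z x, p x) : GraphSpace n (cell d)) v = 0 := by
    refine ae_forall_inner_eq_zero A _ ?_
    rintro _ ⟨φ, hφ, hper, i, j, rfl⟩
    simp only [WithLp.prod_inner_apply]
    exact ae_inner_add_inner_eq_zero hΩ hε hε0 hu hz hp hφ hper i j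
  filter_upwards [key] with x hx φ hφ hper i j
  have h := hx _ ⟨φ, hφ, hper, i, j, rfl⟩
  simp only [WithLp.prod_inner_apply] at h
  rw [← one_mul (inner ℝ (z x) _), ← one_mul (inner ℝ (p x) _),
    ← setIntegral_cell_inner_smul, ← setIntegral_cell_inner_smul, add_eq_zero_iff_eq_neg] at h
  convert h using 1
  · refine integral_congr_ae (Eventually.of_forall fun y => ?_)
    simp [real_inner_smul_right, EuclideanSpace.inner_single_right, mul_comm]
  · congr 1
    refine integral_congr_ae (Eventually.of_forall fun y => ?_)
    simp [real_inner_smul_right, EuclideanSpace.inner_single_right, mul_comm]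

end Limits

/-! ### The weak equation tested at the fast scale. -/

section Flux

variable {d n : ℕ} {Ω : Set (E d)} {ε : ℕ → ℝ}

lemma toReal_eLpNorm_le_mul {α X Y : Type*} [MeasurableSpace α] {μ : Measure α}
    [NormedAddCommGroup X] [NormedAddCommGroup Y] {f : α → X} {g : α → Y} (hg : MemLp g 2 μ)
    {c : ℝ} (hc : 0 ≤ c) (h : ∀ᵐ x ∂μ, ‖f x‖ ≤ c * ‖g x‖) :
    (eLpNorm f 2 μ).toReal ≤ c * (eLpNorm g 2 μ).toReal := by
  have h1 := ENNReal.toReal_mono (ENNReal.mul_ne_top ENNReal.ofReal_ne_top hg.2.ne)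
    (eLpNorm_le_mul_eLpNorm_of_ae_le_mul h 2)
  rwa [ENNReal.toReal_mul, ENNReal.toReal_ofReal hc] at h1

lemma LinftyPerTens.exists_eLpNorm_le {a : E d → Tens4 n d} (ha : LinftyPerTens a)
    (Ω : Set (E d)) : ∃ C, 0 ≤ C ∧ ∀ ε : ℝ, 0 < ε → ∀ g : E d → Tens n d,
      MemLp g 2 (volume.restrict Ω) →
      (eLpNorm (fun x => act (a (ε⁻¹ • x)) (g x)) 2 (volume.restrict Ω)).toReal
        ≤ C * (eLpNorm g 2 (volume.restrict Ω)).toReal := by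
  obtain ⟨C, hC0, hC⟩ := ha.exists_bound
  refine ⟨C, hC0, fun ε hε g hg => toReal_eLpNorm_le_mul hg hC0 ?_⟩
  filter_upwards [ae_smul_of_ae (Ω := Ω) hC hε] with x hx
  exact hx _

lemma LinftyPer.exists_eLpNorm_le {ρ : E d → ℝ} (hρ : LinftyPer ρ) (Ω : Set (E d)) :
    ∃ C, 0 ≤ C ∧ ∀ ε : ℝ, 0 < ε → ∀ g : E d → E n, MemLp g 2 (volume.restrict Ω) →
      (eLpNorm (fun x => ρ (ε⁻¹ • x) • g x) 2 (volume.restrict Ω)).toReal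
        ≤ C * (eLpNorm g 2 (volume.restrict Ω)).toReal := by
  obtain ⟨C, hC0, hC⟩ := hρ.exists_bound
  refine ⟨C, hC0, fun ε hε g hg => toReal_eLpNorm_le_mul hg hC0 ?_⟩
  filter_upwards [ae_smul_of_ae (Ω := Ω) hC hε] with x hx
  rw [norm_smul]
  exact mul_le_mul_of_nonneg_right hx (norm_nonneg _)

lemma integral_add_five {α : Type*} [MeasurableSpace α] {μ : Measure α} {g₁ g₂ g₃ g₄ g₅ : α → ℝ}
    (h₁ : Integrable g₁ μ) (h₂ : Integrable g₂ μ) (h₃ : Integrable g₃ μ) (h₄ : Integrable g₄ μ)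
    (h₅ : Integrable g₅ μ) :
    ∫ x, (g₁ x + g₂ x + g₃ x + g₄ x + g₅ x) ∂μ
      = (∫ x, g₁ x ∂μ) + (∫ x, g₂ x ∂μ) + (∫ x, g₃ x ∂μ) + (∫ x, g₄ x ∂μ) + ∫ x, g₅ x ∂μ := by
  have i₂ : Integrable (fun x => g₁ x + g₂ x) μ := h₁.add h₂
  have i₃ : Integrable (fun x => g₁ x + g₂ x + g₃ x) μ := i₂.add h₃
  have i₄ : Integrable (fun x => g₁ x + g₂ x + g₃ x + g₄ x) μ := i₃.add h₄
  rw [integral_add i₄ h₅, integral_add i₃ h₄, integral_add i₂ h₃, integral_add h₁ h₂]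

/-- The weak equation tested with an oscillating function `θ(x) φ(x/ε)`. -/
lemma weak_equation_oscillating {a₁ a₀ : E d → Tens4 n d} {ρ : E d → ℝ} {lam : ℝ}
    (hρ : LinftyPer ρ) (ha₁ : LinftyPerTens a₁) (ha₀ : LinftyPerTens a₀)
    {e : ℝ} (he : 0 < e) {f : Lp (E n) 2 (volume.restrict Ω)} {u : GraphSpace n Ω}
    (hu : IsWeakSolution Ω a₁ a₀ ρ lam e f u) {θ : E d → ℝ} (hθ : ContDiff ℝ ∞ θ)
    (hc : HasCompactSupport θ) (hs : tsupport θ ⊆ Ω) {φ : E d → E n} (hφ : ContDiff ℝ ∞ φ)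
    (hper : QPeriodic φ) :
    (∫ x in Ω, inner ℝ (act (a₁ (e⁻¹ • x)) (u.snd x)) (θ x • grad φ (e⁻¹ • x)))
      + e * (∫ x in Ω, inner ℝ (act (a₁ (e⁻¹ • x)) (u.snd x)) (tensorGrad θ φ x (e⁻¹ • x)))
      + e * (e * ∫ x in Ω, inner ℝ (act (a₀ (e⁻¹ • x)) (e • u.snd x))
          (tensorGrad θ φ x (e⁻¹ • x)))
      + e * (∫ x in Ω, inner ℝ (act (a₀ (e⁻¹ • x)) (e • u.snd x)) (θ x • grad φ (e⁻¹ • x)))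
      + lam * (e * ∫ x in Ω, inner ℝ (ρ (e⁻¹ • x) • u.fst x) (θ x • φ (e⁻¹ • x)))
      - e * (∫ x in Ω, inner ℝ (f x) (θ x • φ (e⁻¹ • x))) = 0 := by
  have hθK : ∀ x ∉ tsupport θ, θ x = 0 := fun x hx => image_eq_zero_of_notMem_tsupport hx
  have ψ1 := isTestFun_tensorGrad hθ hc hs hφ hper
  have ψ2 : IsTestFun Ω (fun x y => θ x • grad φ y) :=
    isTestFun_smul hθ hc hs hθK (contDiff_grad hφ) hper.grad
  have ψ3 : IsTestFun Ω (fun x y => θ x • φ y) := isTestFun_smul hθ hc hs hθK hφ hper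
  have m1 := (ψ1.memLp_diag e).restrict Ω
  have m2 := (ψ2.memLp_diag e).restrict Ω
  have m3 := (ψ3.memLp_diag e).restrict Ω
  have hY := ha₁.memLp_act_smul he (Lp.memLp u.snd)
  have hes : MemLp (fun x => e • u.snd x) 2 (volume.restrict Ω) := (Lp.memLp u.snd).const_smul e
  have hq := ha₀.memLp_act_smul he hes
  have hr := hρ.memLp_smul he (Lp.memLp u.fst)
  have i1 := integrable_inner_of_memLp hY m2
  have i2 := (integrable_inner_of_memLp hY m1).const_mul e
  have i3 := (integrable_inner_of_memLp hq m1).const_mul (e * e)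
  have i4 := (integrable_inner_of_memLp hq m2).const_mul e
  have i5 := (integrable_inner_of_memLp hr m3).const_mul (lam * e)
  obtain ⟨w, hwH, hw1, hw2⟩ := exists_mem_H10 (Ω := Ω) (smooth_smul_comp_smul hθ hφ e⁻¹)
    hc.smul_right ((tsupport_smul_subset_left _ _).trans hs)
  have hweak := hu.2 w hwH
  -- The factor `e` cancels the `e⁻¹` produced by differentiating `φ(x/e)`; one factor of `e²` is
  -- absorbed into `e∇u`, the quantity known to be bounded.
  have hL : e * (∫ x in Ω, (inner ℝ (act (aEps a₁ a₀ e x) (u.snd x)) (w.snd x)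
        + lam * ρ (e⁻¹ • x) * inner ℝ (u.fst x) (w.fst x)))
      = ∫ x in Ω, (inner ℝ (act (a₁ (e⁻¹ • x)) (u.snd x)) (θ x • grad φ (e⁻¹ • x))
        + e * inner ℝ (act (a₁ (e⁻¹ • x)) (u.snd x)) (tensorGrad θ φ x (e⁻¹ • x))
        + e * e * inner ℝ (act (a₀ (e⁻¹ • x)) (e • u.snd x)) (tensorGrad θ φ x (e⁻¹ • x))
        + e * inner ℝ (act (a₀ (e⁻¹ • x)) (e • u.snd x)) (θ x • grad φ (e⁻¹ • x))
        + lam * e * inner ℝ (ρ (e⁻¹ • x) • u.fst x) (θ x • φ (e⁻¹ • x))) := by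
    rw [← integral_const_mul]
    refine integral_congr_ae ?_
    filter_upwards [hw1, hw2] with x h1 h2
    rw [h1, h2, grad_smul_comp_smul hθ hφ, act_aEps, act_smul_right]
    simp only [inner_add_left, inner_add_right, real_inner_smul_left, real_inner_smul_right]
    field_simp
    ring
  have hR : ∫ x in Ω, inner ℝ (f x) (w.fst x)
      = ∫ x in Ω, inner ℝ (f x) (θ x • φ (e⁻¹ • x)) := by
    refine integral_congr_ae ?_
    filter_upwards [hw1] with x h1
    rw [h1]
  rw [hweak, hR] at hL
  rw [integral_add_five i1 i2 i3 i4 i5] at hL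
  simp only [integral_const_mul] at hL
  rw [hL]
  ring

/-- In `weak_equation_oscillating` every term except the leading flux carries a factor `ε` times a
bounded integral. -/
lemma tendsto_flux_zero {a₁ a₀ : E d → Tens4 n d} {ρ : E d → ℝ} {lam : ℝ}
    (hΩ : MeasurableSet Ω) (hε : ∀ k, 0 < ε k) (hε0 : Tendsto ε atTop (𝓝 0))
    (hρ : LinftyPer ρ) (ha₁ : LinftyPerTens a₁) (ha₀ : LinftyPerTens a₀)
    {f : ℕ → Lp (E n) 2 (volume.restrict Ω)} {u : ℕ → GraphSpace n Ω}
    (hu : ∀ k, IsWeakSolution Ω a₁ a₀ ρ lam (ε k) (f k) (u k)) {K : ℝ}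
    (hf : ∀ k, ‖f k‖ ≤ K) (hfst : ∀ k, ‖(u k).fst‖ ≤ K)
    (hsnd : ∀ k, (eLpNorm (fun x => ε k • (u k).snd x) 2 (volume.restrict Ω)).toReal ≤ K)
    (hflux : ∀ k, (eLpNorm (fun x => act (a₁ ((ε k)⁻¹ • x)) ((u k).snd x)) 2
      (volume.restrict Ω)).toReal ≤ K)
    {θ : E d → ℝ} (hθ : ContDiff ℝ ∞ θ)
    (hc : HasCompactSupport θ) (hs : tsupport θ ⊆ Ω) {φ : E d → E n} (hφ : ContDiff ℝ ∞ φ)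
    (hper : QPeriodic φ) :
    Tendsto (fun k => ∫ x in Ω, inner ℝ (act (a₁ ((ε k)⁻¹ • x)) ((u k).snd x))
      (θ x • grad φ ((ε k)⁻¹ • x))) atTop (𝓝 0) := by
  have hθK : ∀ x ∉ tsupport θ, θ x = 0 := fun x hx => image_eq_zero_of_notMem_tsupport hx
  have ψ1 := isTestFun_tensorGrad hθ hc hs hφ hper
  have ψ2 : IsTestFun Ω (fun x y => θ x • grad φ y) :=
    isTestFun_smul hθ hc hs hθK (contDiff_grad hφ) hper.grad
  have ψ3 : IsTestFun Ω (fun x y => θ x • φ y) := isTestFun_smul hθ hc hs hθK hφ hper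
  have hes : ∀ k, MemLp (fun x => ε k • (u k).snd x) 2 (volume.restrict Ω) :=
    fun k => (Lp.memLp (u k).snd).const_smul (ε k)
  obtain ⟨C₀, hC₀, hb₀⟩ := ha₀.exists_eLpNorm_le Ω
  obtain ⟨Cρ, hCρ, hbρ⟩ := hρ.exists_eLpNorm_le (n := n) Ω
  have t1 := tendsto_mul_setIntegral_zero hε hε0 hΩ
    (fun k => ha₁.memLp_act_smul (hε k) (Lp.memLp (u k).snd)) hflux ψ1
  have hq : ∀ k, (eLpNorm (fun x => act (a₀ ((ε k)⁻¹ • x)) (ε k • (u k).snd x)) 2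
      (volume.restrict Ω)).toReal ≤ C₀ * K := fun k =>
    (hb₀ _ (hε k) _ (hes k)).trans (mul_le_mul_of_nonneg_left (hsnd k) hC₀)
  have t2 := tendsto_mul_setIntegral_zero hε hε0 hΩ
    (fun k => ha₀.memLp_act_smul (hε k) (hes k)) hq ψ1
  have t3 := tendsto_mul_setIntegral_zero hε hε0 hΩ
    (fun k => ha₀.memLp_act_smul (hε k) (hes k)) hq ψ2
  have hr : ∀ k, (eLpNorm (fun x => ρ ((ε k)⁻¹ • x) • (u k).fst x) 2
      (volume.restrict Ω)).toReal ≤ Cρ * K := fun k =>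
    (hbρ _ (hε k) _ (Lp.memLp (u k).fst)).trans (mul_le_mul_of_nonneg_left (hfst k) hCρ)
  have t4 := tendsto_mul_setIntegral_zero hε hε0 hΩ
    (fun k => hρ.memLp_smul (hε k) (Lp.memLp (u k).fst)) hr ψ3
  have t5 := tendsto_mul_setIntegral_zero hε hε0 hΩ (w := fun k x => f k x)
    (fun k => Lp.memLp (f k)) (C := K) hf ψ3
  have hsum := t5.sub (((t1.add (hε0.mul t2)).add t3).add (t4.const_mul lam))
  simp only [mul_zero, add_zero, sub_zero] at hsum
  refine hsum.congr fun k => ?_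
  have := weak_equation_oscillating hρ ha₁ ha₀ (hε k) (hu k) hθ hc hs hφ hper
  linarith

end Flux

/-! ### Extraction of the subsequence and identification of the limits. -/

section Compactness

variable {d n : ℕ} {Ω : Set (E d)} {ε : ℕ → ℝ}

lemma exists_unfoldLp_weakTendsto {F : Type*} [NormedAddCommGroup F] [InnerProductSpace ℝ F]
    [FiniteDimensional ℝ F] (hε : ∀ k, 0 < ε k) (hΩ : MeasurableSet Ω) {w : ℕ → E d → F}
    (hw : ∀ k, MemLp (w k) 2 (volume.restrict Ω)) {C : ℝ}
    (hC : ∀ k, (eLpNorm (w k) 2 (volume.restrict Ω)).toReal ≤ C) :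
    ∃ s : ℕ → ℕ, StrictMono s ∧ ∃ z : UnfoldL2 d F, WeakTendsto
      (fun k => unfoldLp (memLp_indicator_of_restrict hΩ (hw (s k))) (hε (s k))) z := by
  have : CompleteSpace F := FiniteDimensional.complete ℝ F
  refine exists_weakTendsto_subseq
    (fun k => unfoldLp (memLp_indicator_of_restrict hΩ (hw k)) (hε k)) (C := C) fun k => ?_
  rw [norm_unfoldLp, eLpNorm_indicator_eq_eLpNorm_restrict hΩ]
  exact hC k

/-- Here `a(εg) = ε a^{1/2}(a^{1/2}g)` has norm at most `εCK`, so its unfolding tends strongly to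
zero; it also tends weakly to the image of `p` under multiplication by `a(y)`. -/
lemma ae_act_eq_zero {a : E d → Tens4 n d} (ha : LinftyPerTens a)
    (hpos : ∀ᵐ y, (a y).PosSemidef) (hΩ : MeasurableSet Ω) (hε : ∀ k, 0 < ε k)
    (hε0 : Tendsto ε atTop (𝓝 0)) {g : ℕ → E d → Tens n d}
    (hg : ∀ k, MemLp (g k) 2 (volume.restrict Ω))
    (heg : ∀ k, MemLp (fun x => ε k • g k x) 2 (volume.restrict Ω)) {K : ℝ}
    (hK : ∀ k, (eLpNorm (fun x => act (tsqrt (a ((ε k)⁻¹ • x))) (g k x)) 2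
      (volume.restrict Ω)).toReal ≤ K) {p : UnfoldL2 d (Tens n d)}
    (hp : WeakTendsto (fun k => unfoldLp (memLp_indicator_of_restrict hΩ (heg k)) (hε k)) p) :
    ∀ᵐ x, ∀ᵐ y ∂(volume.restrict (cell d)), act (a y) (p x y) = 0 := by
  obtain ⟨C, hC0, hC⟩ := (ha.tsqrt hpos).exists_bound
  have hnorm : Tendsto (fun k => ha.unfoldAct
      (unfoldLp (memLp_indicator_of_restrict hΩ (heg k)) (hε k))) atTop (𝓝 0) := by
    refine squeeze_zero_norm (a := fun k => ε k * C * K) (fun k => ?_) ?_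
    · rw [ha.unfoldAct_unfoldLp hΩ (heg k) (hε k), norm_unfoldLp,
         eLpNorm_indicator_eq_eLpNorm_restrict hΩ]
      have hεC : 0 ≤ ε k * C := mul_nonneg (hε k).le hC0
      refine (toReal_eLpNorm_le_mul ((ha.tsqrt hpos).memLp_act_smul (hε k) (hg k)) hεC
        ?_).trans (mul_le_mul_of_nonneg_left (hK k) hεC)
      filter_upwards [ae_smul_of_ae (Ω := Ω) hpos (hε k), ae_smul_of_ae (Ω := Ω) hC (hε k)]
        with x h1 h2
      rw [act_smul_right, norm_smul, Real.norm_of_nonneg (hε k).le, mul_assoc]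
      refine mul_le_mul_of_nonneg_left ?_ (hε k).le
      conv_lhs => rw [← tsqrt_mul_self h1, act_mul]
      exact h2 _
    · simpa using (hε0.mul_const C).mul_const K
  have hzero : ha.unfoldAct p = 0 := (hp.map ha.unfoldAct).eq_of_tendsto hnorm
  have hcoe : ha.unfoldAct p =ᵐ[volume] 0 := by
    rw [hzero]
    exact Lp.coeFn_zero _ _ _
  filter_upwards [hcoe, ha.coeFn_unfoldAct p] with x h1 h2
  have h3 : ha.cellAct (p x) = 0 := by
    rw [← h2, h1]
    rfl
  have h4 : ha.cellAct (p x) =ᵐ[volume.restrict (cell d)] 0 := by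
    rw [h3]
    exact Lp.coeFn_zero _ _ _
  filter_upwards [h4, ha.coeFn_cellAct (p x)] with y h5 h6
  rw [← h6, h5]
  rfl

/-- A field in `L²(Ω; L²(Q)^{n×d})` whose pairings with `θ(x) ∇φ(y)` vanish is, for almost every
`x`, orthogonal to all gradients of periodic functions. -/
lemma ae_forall_H1per_inner_eq_zero (hΩ : IsOpen Ω) {z : E d → CellL2 d (Tens n d)}
    (hz : MemLp z 2 (volume.restrict Ω))
    (h : ∀ θ : E d → ℝ, ContDiff ℝ ∞ θ → HasCompactSupport θ → tsupport θ ⊆ Ω →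
      ∀ φ : E d → E n, ContDiff ℝ ∞ φ → QPeriodic φ →
        ∫ x in Ω, ∫ y in cell d, inner ℝ (z x y) (θ x • grad φ y) = 0) :
    ∀ᵐ x ∂(volume.restrict Ω), ∀ w ∈ H1per d n,
      ∫ y in cell d, inner ℝ (z x y) (w.snd y) = 0 := by
  have hm : ∀ {φ : E d → E n}, ContDiff ℝ ∞ φ → MemLp (grad φ) 2 (volume.restrict (cell d)) :=
    fun hφ => memLp_cell_of_continuous (continuous_grad hφ)
  let A : Set (CellL2 d (Tens n d)) := {v | ∃ (φ : E d → E n) (hφ : ContDiff ℝ ∞ φ)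
    (_ : QPeriodic φ), v = (hm hφ).toLp}
  have key : ∀ᵐ x ∂(volume.restrict Ω), ∀ v ∈ A, inner ℝ (z x) v = 0 := by
    refine ae_forall_inner_eq_zero A _ ?_
    rintro v ⟨φ, hφ, hper, hv⟩
    refine ae_eq_zero_of_setIntegral_mul_eq_zero hΩ (hz.inner_const v) fun θ hθ hc hs => ?_
    rw [← h θ hθ hc hs φ hφ hper]
    simp only [setIntegral_cell_inner_smul _ (hm hφ), hv]
  filter_upwards [key] with x hx w hw
  refine integral_inner_snd_eq_zero (Lp.memLp (z x)) (fun φ hφ hper => ?_) hw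
  have h1 := hx _ ⟨φ, hφ, hper, rfl⟩
  rw [← one_mul (inner ℝ (z x) _), ← setIntegral_cell_inner_smul] at h1
  simpa only [one_smul] using h1

theorem exists_two_scale_limits (hΩ : IsOpen Ω) (hε : ∀ k, 0 < ε k)
    (hε0 : Tendsto ε atTop (𝓝 0)) {a₁ a₀ : E d → Tens4 n d} {ρ : E d → ℝ} {lam : ℝ}
    (hρ : LinftyPer ρ) (ha₁ : LinftyPerTens a₁) (ha₀ : LinftyPerTens a₀)
    (hpos : ∀ᵐ y, (a₁ y).PosSemidef)
    {f : ℕ → Lp (E n) 2 (volume.restrict Ω)} {u : ℕ → GraphSpace n Ω}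
    (hu : ∀ k, IsWeakSolution Ω a₁ a₀ ρ lam (ε k) (f k) (u k)) {K : ℝ}
    (hf : ∀ k, ‖f k‖ ≤ K) (hfst : ∀ k, ‖(u k).fst‖ ≤ K) (hsnd : ∀ k, ε k * ‖(u k).snd‖ ≤ K)
    (hS : ∀ k, (eLpNorm (fun x => act (tsqrt (a₁ ((ε k)⁻¹ • x))) ((u k).snd x)) 2
      (volume.restrict Ω)).toReal ≤ K) :
    ∃ s : ℕ → ℕ, StrictMono s ∧
      ∃ u₀ ∈ L2Into Ω (V a₁), ∃ ξ₀ ∈ L2Into Ω (W a₁),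
        TwoScaleConverges Ω (fun k => ε (s k))
          (fun k x => (u (s k)).fst x) (fun x => (u₀ x).fst) ∧
        TwoScaleConverges Ω (fun k => ε (s k))
          (fun k x => ε (s k) • (u (s k)).snd x) (fun x => (u₀ x).snd) ∧
        TwoScaleConverges Ω (fun k => ε (s k))
          (fun k x => act (tsqrt (a₁ ((ε (s k))⁻¹ • x))) ((u (s k)).snd x)) ξ₀ := by
  have hΩm := hΩ.measurableSet
  have hb := ha₁.tsqrt hpos
  have m1 : ∀ k, MemLp (fun x => (u k).fst x) 2 (volume.restrict Ω) := fun k => Lp.memLp _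
  have m2 : ∀ k, MemLp (fun x => ε k • (u k).snd x) 2 (volume.restrict Ω) :=
    fun k => (Lp.memLp (u k).snd).const_smul (ε k)
  have m3 : ∀ k, MemLp (fun x => act (tsqrt (a₁ ((ε k)⁻¹ • x))) ((u k).snd x)) 2
    (volume.restrict Ω) := fun k => hb.memLp_act_smul (hε k) (Lp.memLp (u k).snd)
  have b1 : ∀ k, (eLpNorm (fun x => (u k).fst x) 2 (volume.restrict Ω)).toReal ≤ K := hfst
  have b2 : ∀ k, (eLpNorm (fun x => ε k • (u k).snd x) 2 (volume.restrict Ω)).toReal ≤ K := by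
    intro k
    refine (toReal_eLpNorm_le_mul (Lp.memLp (u k).snd) (hε k).le
      (Eventually.of_forall fun x => ?_)).trans (hsnd k)
    rw [norm_smul, Real.norm_of_nonneg (hε k).le]
  obtain ⟨s₁, hs₁, z, hz⟩ := exists_unfoldLp_weakTendsto hε hΩm m1 b1
  obtain ⟨s₂, hs₂, p, hp⟩ := exists_unfoldLp_weakTendsto (fun k => hε (s₁ k)) hΩm
    (fun k => m2 (s₁ k)) (fun k => b2 (s₁ k))
  obtain ⟨s₃, hs₃, ξ, hξ⟩ := exists_unfoldLp_weakTendsto (fun k => hε (s₁ (s₂ k))) hΩm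
    (fun k => m3 (s₁ (s₂ k))) (fun k => hS (s₁ (s₂ k)))
  -- Successive extraction gives one subsequence for all three weak limits.
  obtain ⟨s, hs⟩ : ∃ s : ℕ → ℕ, s = fun k => s₁ (s₂ (s₃ k)) := ⟨_, rfl⟩
  have hsm : StrictMono s := by
    rw [hs]
    exact hs₁.comp (hs₂.comp hs₃)
  have hz' : WeakTendsto (fun k => unfoldLp (memLp_indicator_of_restrict hΩm (m1 (s k)))
      (hε (s k))) z := by
    subst hs
    exact (hz.comp hs₂).comp hs₃
  have hp' : WeakTendsto (fun k => unfoldLp (memLp_indicator_of_restrict hΩm (m2 (s k)))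
      (hε (s k))) p := by
    subst hs
    exact hp.comp hs₃
  have hξ' : WeakTendsto (fun k => unfoldLp (memLp_indicator_of_restrict hΩm (m3 (s k)))
      (hε (s k))) ξ := by
    subst hs
    exact hξ
  have hε' : ∀ k, 0 < ε (s k) := fun k => hε (s k)
  have hε0' : Tendsto (fun k => ε (s k)) atTop (𝓝 0) := hε0.comp hsm.tendsto_atTop
  have T1 := twoScaleConverges_of_weakTendsto hε' hε0' hΩm (fun k => m1 (s k))
    (fun k => b1 (s k)) hz'
  have T2 := twoScaleConverges_of_weakTendsto hε' hε0' hΩm (fun k => m2 (s k))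
    (fun k => b2 (s k)) hp'
  have T3 := twoScaleConverges_of_weakTendsto hε' hε0' hΩm (fun k => m3 (s k))
    (fun k => hS (s k)) hξ'
  refine ⟨s, hsm, fun x => WithLp.toLp 2 (z x, p x), ⟨?_, ?_⟩, fun x => ξ x, ⟨T3.2.2.1, ?_⟩,
    T1, T2, T3⟩
  · exact memLp_prodLp_iff.2 ⟨T1.2.2.1, T2.2.2.1⟩
  · filter_upwards [ae_mem_H1per hΩ hε' hε0' (fun k => (hu (s k)).1) T1 T2,
      ae_restrict_of_ae (ae_act_eq_zero ha₁ hpos hΩm hε' hε0'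
        (fun k => Lp.memLp (u (s k)).snd) (fun k => m2 (s k)) (fun k => hS (s k)) hp')]
      with x h1 h2
    exact ⟨h1, h2⟩
  · obtain ⟨C, hC0, hC⟩ := hb.exists_eLpNorm_le Ω
    have m4 := fun k => hb.memLp_act_smul (hε k) (m3 k)
    have b4 : ∀ k, (eLpNorm (fun x => act (tsqrt (a₁ ((ε k)⁻¹ • x)))
        (act (tsqrt (a₁ ((ε k)⁻¹ • x))) ((u k).snd x))) 2 (volume.restrict Ω)).toReal ≤ C * K :=
      fun k => (hC _ (hε k) _ (m3 k)).trans (mul_le_mul_of_nonneg_left (hS k) hC0)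
    -- The flux is the root applied to the third sequence, so its unfolding converges weakly to the
    -- root applied to `ξ`, the field whose divergence must vanish.
    have hae : ∀ k, (fun x => act (tsqrt (a₁ ((ε k)⁻¹ • x)))
        (act (tsqrt (a₁ ((ε k)⁻¹ • x))) ((u k).snd x))) =ᵐ[volume.restrict Ω]
        fun x => act (a₁ ((ε k)⁻¹ • x)) ((u k).snd x) := by
      intro k
      filter_upwards [ae_smul_of_ae (Ω := Ω) hpos (hε k)] with x hx
      rw [← act_mul, tsqrt_mul_self hx]
    have hY : WeakTendsto (fun k => unfoldLp (memLp_indicator_of_restrict hΩm (m4 (s k)))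
        (hε (s k))) (hb.unfoldAct ξ) := by
      have e : ∀ k, hb.unfoldAct (unfoldLp (memLp_indicator_of_restrict hΩm (m3 (s k)))
          (hε (s k))) = unfoldLp (memLp_indicator_of_restrict hΩm (m4 (s k))) (hε (s k)) :=
        fun k => hb.unfoldAct_unfoldLp hΩm (m3 (s k)) (hε (s k))
      simpa only [e] using hξ'.map hb.unfoldAct
    have hzero := ae_forall_H1per_inner_eq_zero (n := n) hΩ
      (z := fun x => hb.unfoldAct ξ x) ((Lp.memLp _).restrict Ω) (by
        intro θ hθ hc hs φ hφ hper
        have ψ : IsTestFun Ω (fun x y => θ x • grad φ y) :=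
          isTestFun_smul hθ hc hs (fun x hx => image_eq_zero_of_notMem_tsupport hx)
            (contDiff_grad hφ) hper.grad
        have l1 := hY.tendsto_setIntegral hε' hε0' hΩm (fun k => m4 (s k)) (fun k => b4 (s k)) ψ
        have l2 := tendsto_flux_zero hΩm hε' hε0' hρ ha₁ ha₀ (fun k => hu (s k))
          (K := max K (C * K))
          (fun k => (hf (s k)).trans (le_max_left _ _))
          (fun k => (hfst (s k)).trans (le_max_left _ _))
          (fun k => (b2 (s k)).trans (le_max_left _ _))
          (fun k => by
            rw [← eLpNorm_congr_ae (hae (s k))]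
            exact (b4 (s k)).trans (le_max_right _ _)) hθ hc hs hφ hper
        refine tendsto_nhds_unique l1 (l2.congr fun k => ?_)
        refine integral_congr_ae ?_
        filter_upwards [hae (s k)] with x hx
        rw [hx])
    filter_upwards [hzero, ae_restrict_of_ae (hb.coeFn_unfoldAct ξ)] with x h1 h2 w hw
    rw [← h1 w hw]
    beta_reduce
    rw [h2]
    refine integral_congr_ae ?_
    filter_upwards [hb.coeFn_cellAct (ξ x)] with y hy
    rw [hy]

end Compactness

lemma toReal_eLpNorm_le_sqrt {α F : Type*} [MeasurableSpace α] {μ : Measure α}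
    [NormedAddCommGroup F] [InnerProductSpace ℝ F] {g : α → F} (hg : MemLp g 2 μ) {B : ℝ}
    (hB : ∫ x, ‖g x‖ ^ 2 ∂μ ≤ B) : (eLpNorm g 2 μ).toReal ≤ √B := by
  rw [← Lp.norm_toLp g hg]
  refine Real.le_sqrt_of_sq_le ?_
  rw [norm_sq_eq_integral]
  refine le_of_eq_of_le (integral_congr_ae ?_) hB
  filter_upwards [hg.coeFn_toLp] with x hx
  rw [hx]

end TwoScale

end

theorem mainTheorem3 (d n : ℕ) (hd : 2 ≤ d) (hn : 1 ≤ n)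
    (Ω : Set (TwoScale.E d)) (hΩ : IsOpen Ω)
    (lam ν : ℝ) (hlam : 0 < lam) (hν : 0 < ν)
    -- the density
    (ρ : TwoScale.E d → ℝ) (hρ : TwoScale.LinftyPer ρ) (hρν : ∀ᵐ y, ν ≤ ρ y)
    -- the tensors: bounded, periodic, symmetric
    (a₁ a₀ : TwoScale.E d → TwoScale.Tens4 n d)
    (ha₁ : ∀ p q, TwoScale.LinftyPer (fun y => a₁ y p q))
    (ha₀ : ∀ p q, TwoScale.LinftyPer (fun y => a₀ y p q))
    (hsymm₁ : ∀ᵐ y, (a₁ y).IsSymm) (hsymm₀ : ∀ᵐ y, (a₀ y).IsSymm)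
    -- non-negativity of the leading tensor
    (hnonneg : ∀ᵐ y, ∀ ζ : TwoScale.Tens n d, 0 ≤ inner ℝ (TwoScale.act (a₁ y) ζ) ζ)
    -- strong uniform ellipticity of the sum, through a constant tensor
    (A₀ : TwoScale.Tens4 n d)
    (hcoer : ∀ᵐ y, ∀ ζ : TwoScale.Tens n d,
      inner ℝ (TwoScale.act A₀ ζ) ζ ≤ inner ℝ (TwoScale.act (a₀ y + a₁ y) ζ) ζ)
    (hA₀ : ∀ (ξ : TwoScale.E n) (η : TwoScale.E d),
      ν * ‖ξ‖ ^ 2 * ‖η‖ ^ 2 ≤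
        inner ℝ (TwoScale.act A₀ (WithLp.toLp 2 (fun p => ξ p.1 * η p.2)))
          (WithLp.toLp 2 (fun p => ξ p.1 * η p.2)))
    -- a sequence of small parameters, bounded forcings, and the solutions
    (ε : ℕ → ℝ) (hε : ∀ k, 0 < ε k) (hε0 : Filter.Tendsto ε Filter.atTop (nhds 0))
    (f : ℕ → MeasureTheory.Lp (TwoScale.E n) 2 (MeasureTheory.volume.restrict Ω))
    (hf : ∃ C : ℝ, ∀ k, ‖f k‖ ≤ C)
    (u : ℕ → TwoScale.GraphSpace n Ω)
    (hu : ∀ k, TwoScale.IsWeakSolution Ω a₁ a₀ ρ lam (ε k) (f k) (u k)) :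
    ∃ s : ℕ → ℕ, StrictMono s ∧
      ∃ u₀ ∈ TwoScale.L2Into Ω (TwoScale.V a₁), ∃ ξ₀ ∈ TwoScale.L2Into Ω (TwoScale.W a₁),
        TwoScale.TwoScaleConverges Ω (fun k => ε (s k))
          (fun k x => (u (s k)).fst x) (fun x => (u₀ x).fst) ∧
        TwoScale.TwoScaleConverges Ω (fun k => ε (s k))
          (fun k x => ε (s k) • (u (s k)).snd x) (fun x => (u₀ x).snd) ∧
        TwoScale.TwoScaleConverges Ω (fun k => ε (s k))
          (fun k x => TwoScale.act (TwoScale.tsqrt (a₁ ((ε (s k))⁻¹ • x))) ((u (s k)).snd x)) ξ₀ := by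
  have hpos : ∀ᵐ y, (a₁ y).PosSemidef := by
    filter_upwards [hsymm₁, hnonneg] with y h1 h2
    exact TwoScale.posSemidef_of_inner_act h1 h2
  obtain ⟨C, hC⟩ := hf
  have hC0 : 0 ≤ C := (norm_nonneg _).trans (hC 0)
  -- The energy estimate needs `ε² ≤ 1/2`, so the first `N` terms are dropped and the final
  -- subsequence is shifted by `N`.
  obtain ⟨N, hN⟩ : ∃ N, ∀ k, N ≤ k → ε k ^ 2 ≤ 1 / 2 := by
    have h : Tendsto (fun k => ε k ^ 2) atTop (𝓝 0) := by simpa using hε0.pow 2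
    exact eventually_atTop.1 (h.eventually (eventually_le_nhds (by norm_num)))
  obtain ⟨B, hB⟩ : ∃ B, B = C * (C / (lam * ν)) := ⟨_, rfl⟩
  have bounds : ∀ k, N ≤ k → ‖(u k).fst‖ ≤ C / (lam * ν) ∧ ε k * ‖(u k).snd‖ ≤ √(B / ν) ∧
      (eLpNorm (fun x => TwoScale.act (TwoScale.tsqrt (a₁ ((ε k)⁻¹ • x))) ((u k).snd x)) 2
        (volume.restrict Ω)).toReal ≤ √(2 * B) := by
    intro k hk
    obtain ⟨h1, h2, h3⟩ := TwoScale.norm_bounds_of_energy hlam hν (norm_nonneg _) hC0 (hC k)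
      (TwoScale.energy_estimate hlam hρ hρν ha₁ ha₀ hpos hcoer hA₀ (hε k) (hN k hk) (hu k))
      (integral_nonneg fun x => sq_nonneg _)
    rw [hB]
    exact ⟨h1, h2, TwoScale.toReal_eLpNorm_le_sqrt
      ((TwoScale.LinftyPerTens.tsqrt ha₁ hpos).memLp_act_smul (hε k) (Lp.memLp (u k).snd)) h3⟩
  obtain ⟨K, hK⟩ : ∃ K, K = max (max C (C / (lam * ν))) (max √(B / ν) √(2 * B)) := ⟨_, rfl⟩
  have hle : ∀ k, N ≤ k + N := fun k => Nat.le_add_left N k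
  obtain ⟨s, hs, u₀, hu₀, ξ₀, hξ₀, T1, T2, T3⟩ :=
    TwoScale.exists_two_scale_limits hΩ (fun k => hε (k + N))
      (hε0.comp (tendsto_add_atTop_nat N)) hρ ha₁ ha₀ hpos (fun k => hu (k + N)) (K := K)
      (fun k => (hC _).trans (by simp [hK]))
      (fun k => (bounds _ (hle k)).1.trans (by simp [hK]))
      (fun k => (bounds _ (hle k)).2.1.trans (by simp [hK]))
      (fun k => (bounds _ (hle k)).2.2.trans (by simp [hK]))
  exact ⟨fun k => s k + N, hs.add_const N, u₀, hu₀, ξ₀, hξ₀, T1, T2, T3⟩
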